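/- **Theorem.** Let $\alpha\in(0,1)$, $c=1/\sum_{k\ge 0}e^{-k^\alpha}$, and let $X_1,X_2,\dots$ be i.i.d. random variables with values in $\mathbb N_0=\{0,1,2,\dots\}$ and law $\mathbb P(X_i=k)=c\,e^{-k^\alpha}$ for $k\in\mathbb N_0$. Let $\mu=\mathbb E[X_1]$, let $\sigma^2$ be the variance of $X_1$, let $S_n=X_1+\cdots+X_n$ and $\gamma=\frac1{2-\alpha}$. Let $s\in\mathbb R$ and let $(s_n)_{n\ge 1}$ be a sequence of real numbers with $s_n\to s$ and $\mu n+s_nn^\gamma\in\mathbb N_0$ for all $n\ge1$. Let $X_{[1:n]}\ge X_{[2:n]}\ge\cdots\ge X_{[n:n]}$ be the decreasing rearrangement of $X_1,\dots,X_n$, and put $X_{[j:n]}=0$ for $j\ge n+1$. Let $\mathcal D\subset[0,\infty)^{\mathbb N}$ be the space of decreasing (i.e. non-increasing) sequences $x_1\ge x_2\ge\cdots\ge 0$, with the subspace topology of the product topology, and define $F_s:\mathcal D\to[0,\infty]$ by $$F_s(x)=\sum_{j=1}^\infty x_j^\alpha+\frac1{2\sigma^2}\Bigl(s-\sum_{j=1}^\infty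 x_j\Bigr)^2,$$ where the second term is $\infty$ if $\sum_j x_j=\infty$. Put $I_s=F_s-\inf_{\mathcal D}F_s$. Let $\mathbb Q_{n,s_n}$ be the distribution of $\bigl(X_{[j:n]}/n^\gamma\bigr)_{j\in\mathbb N}$ on $\mathcal D$ under the conditional law $\mathbb P(\,\cdot\mid S_n=\mu n+s_nn^\gamma)$. Then $(\mathbb Q_{n,s_n})_{n\ge 1}$ satisfies the large deviation principle with speed $n^{\gamma\alpha}$ (which tends to $\infty$) and good rate function $I_s$. That is, $I_s$ is lower semicontinuous with compact sublevel sets $\{x\in\mathcal D: I_s(x)\le a\}$, $a\in[0,\infty)$; for every closed set $\mathcal A\subset\mathcal D$, $$\limsup_{n\to\infty}\frac1{n^{\gamma\alpha}}\log\mathbb Q_{n,s_n}(\mathcal A)\le-\inf_{\mathcal A}I_s;$$ and for every open set $\mathcal O\subset\mathcal D$, $$\liminf_{n\to\infty}\frac1{n^{\gamma\alpha}}\log\mathbb Q_{n,s_n}(\mathcal O)\ge-\inf_{\mathcal O}I_s,$$ with the conventions $\log 0=-\infty$ and $\inf\emptyset=\infty$. -/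

import Mathlib

open MeasureTheory ProbabilityTheory Filter Topology
open scoped NNReal ENNReal

noncomputable section

/-- The sequence of measures `Q` on `E` satisfies the large deviation principle with speed `v`
and good rate function `I`. Logarithms, `limsup`, `liminf` and infima are taken in `[-∞, ∞]`,
with `log 0 = -∞` and `inf ∅ = ∞`. -/
structure SatisfiesLDP {E : Type*} [TopologicalSpace E] [MeasurableSpace E]
    (Q : ℕ → Measure E) (v : ℕ → ℝ) (I : E → ℝ≥0∞) : Prop where
  speed_tendsto : Tendsto v atTop atTop
  lowerSemicontinuous : LowerSemicontinuous I
  isCompact_sublevel : ∀ a : ℝ≥0, IsCompact {x | I x ≤ (a : ℝ≥0∞)}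
  upper_bound : ∀ A : Set E, IsClosed A →
    limsup (fun n => ((1 / v n : ℝ) : EReal) * ENNReal.log (Q n A)) atTop
      ≤ -(⨅ x ∈ A, (I x : EReal))
  lower_bound : ∀ O : Set E, IsOpen O →
    -(⨅ x ∈ O, (I x : EReal))
      ≤ liminf (fun n => ((1 / v n : ℝ) : EReal) * ENNReal.log (Q n O)) atTop

/-- Decreasing sequences of nonnegative reals (indexed from `0`), with the subspace topology of
the product topology and the corresponding σ-algebra. -/
abbrev DecSeq : Type := {x : ℕ → ℝ≥0 // Antitone x}

/-- The function `F_s(x) = ∑ x_j^α + (s - ∑ x_j)² / (2σ²)`, with values in `[0, ∞]`;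
the parameter `v` is the variance `σ²`. The second term is `∞` when `∑ x_j = ∞`. -/
def energy (α v s : ℝ) (x : DecSeq) : ℝ≥0∞ :=
  (∑' j, (x.1 j : ℝ≥0∞) ^ α) +
    if (∑' j, (x.1 j : ℝ≥0∞)) = ⊤ then ⊤
    else ENNReal.ofReal ((s - (∑' j, (x.1 j : ℝ≥0∞)).toReal) ^ 2 / (2 * v))

/-- The `j`-th entry, counted from `j = 0`, of the tuple `x` rearranged in decreasing order;
it is `0` for `j ≥ n`. -/
def revOrderStat {n : ℕ} (x : Fin n → ℕ) (j : ℕ) : ℕ :=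
  if h : j < n then x (Tuple.sort x (Fin.rev ⟨j, h⟩)) else 0

theorem revOrderStat_antitone {n : ℕ} (x : Fin n → ℕ) : Antitone (revOrderStat x) := by
  intro j k hjk
  by_cases hk : k < n
  · have hj : j < n := lt_of_le_of_lt hjk hk
    simp only [revOrderStat, hk, hj, dif_pos]
    exact Tuple.monotone_sort x (Fin.rev_le_rev.mpr hjk)
  · simp [revOrderStat, hk]

/-- The sequence of reversed order statistics of `x`, divided by `n ^ γ`. -/
def scaledOrderStats (γ : ℝ) {n : ℕ} (x : Fin n → ℕ) : DecSeq :=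
  ⟨fun j => (revOrderStat x j : ℝ≥0) / (n : ℝ≥0) ^ γ, fun _ _ h => by
    have h' : (revOrderStat x _ : ℝ≥0) ≤ revOrderStat x _ :=
      Nat.cast_le.mpr (revOrderStat_antitone x h)
    exact div_le_div_of_nonneg_right h' (zero_le)⟩

end

/-!
A sum `S_n = μ n + s_n n ^ γ` is produced by finitely many variables of order `n ^ γ` together with
a collective shift of the others. A variable of size `x n ^ γ` costs `exp (-x ^ α n ^ (γ α))`. A
shift by `u n ^ γ` of the others is a moderate deviation, of Gaussian cost
`exp (-u ^ 2 / (2 σ ^ 2) * n ^ (2 γ - 1))`, and `γ = 1 / (2 - α)` is the exponent for which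
`2 γ - 1 = γ α`, so that both effects live at the same speed and the total cost is `F_s`.

Upper bound: take a union over the positions of the `K` largest variables and apply the exponential
Chebyshev inequality with tilt `t n ^ (γ - 1)` to the rest, truncated at a small multiple of
`n ^ γ`; optimising over `t` gives the Gaussian term, and concavity of `x ↦ x ^ α` makes a small
entry cost more than the tilt gains from it, which controls the tail of the sequence.

Lower bound: prescribe `K` variables, let a tilted window event control the sum of all but one of
the others, and use that one variable to hit the integer `μ n + s_n n ^ γ` exactly.

These bounds give a large deviation principle with rate `F_s` for the order statistics on the event
`S_n = μ n + s_n n ^ γ`; dividing by the total mass of that event subtracts `inf F_s`.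
-/

/-! ### Criteria for large deviation principles -/

theorem inv_mul_log_le {V L : ℝ} (hV : 0 < V) {q : ℝ≥0∞}
    (h : q ≤ ENNReal.ofReal (Real.exp (-(V * L)))) :
    ((1 / V : ℝ) : EReal) * ENNReal.log q ≤ ((-L : ℝ) : EReal) := by
  have hlog := ENNReal.log_le_log h
  rw [ENNReal.log_ofReal_of_pos (Real.exp_pos _), Real.log_exp] at hlog
  calc ((1 / V : ℝ) : EReal) * ENNReal.log q
      ≤ ((1 / V : ℝ) : EReal) * ((-(V * L) : ℝ) : EReal) :=
        mul_le_mul_of_nonneg_left hlog (by exact_mod_cast (one_div_pos.mpr hV).le)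
    _ = ((-L : ℝ) : EReal) := by rw [← EReal.coe_mul]; congr 1; field_simp

theorem le_inv_mul_log {V L : ℝ} (hV : 0 < V) {q : ℝ≥0∞}
    (h : ENNReal.ofReal (Real.exp (-(V * L))) ≤ q) :
    ((-L : ℝ) : EReal) ≤ ((1 / V : ℝ) : EReal) * ENNReal.log q := by
  have hlog := ENNReal.log_le_log h
  rw [ENNReal.log_ofReal_of_pos (Real.exp_pos _), Real.log_exp] at hlog
  calc ((-L : ℝ) : EReal)
      = ((1 / V : ℝ) : EReal) * ((-(V * L) : ℝ) : EReal) := by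
        rw [← EReal.coe_mul]; congr 1; field_simp
    _ ≤ ((1 / V : ℝ) : EReal) * ENNReal.log q :=
        mul_le_mul_of_nonneg_left hlog (by exact_mod_cast (one_div_pos.mpr hV).le)

theorem iInf₂_coe_tsub {E : Type*} {I : ℝ≥0∞} (hI : I ≠ ⊤) {G : E → ℝ≥0∞} (hG : ∀ x, I ≤ G x)
    (A : Set E) :
    ⨅ x ∈ A, ((G x - I : ℝ≥0∞) : EReal) = (⨅ x ∈ A, (G x : EReal)) - I := by
  have hbot : (I : EReal) ≠ ⊥ := EReal.coe_ennreal_ne_bot I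
  have htop : (I : EReal) ≠ ⊤ := EReal.coe_ennreal_eq_top_iff.not.mpr hI
  have hcoe (x : E) : ((G x - I : ℝ≥0∞) : EReal) + I = G x := by
    rw [← EReal.coe_ennreal_add, tsub_add_cancel_of_le (hG x)]
  refine le_antisymm ((EReal.le_sub_iff_add_le (.inl hbot) (.inl htop)).mpr ?_)
    (le_iInf₂ fun x hx => EReal.sub_le_of_le_add ?_)
  · refine le_iInf₂ fun x hx => ?_
    rw [← hcoe x]
    gcongr
    exact iInf₂_le x hx
  · rw [hcoe x]
    exact iInf₂_le x hx

section Criteria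

variable {E : Type*} [TopologicalSpace E] [MeasurableSpace E]
  {M : ℕ → Measure E} {V : ℕ → ℝ} {F : E → ℝ≥0∞}

theorem eventually_natCast_mul_exp_le (hV : Tendsto V atTop atTop) (m : ℕ) {l L : ℝ} (hl : l < L) :
    ∀ᶠ n in atTop, (m : ℝ≥0∞) * ENNReal.ofReal (Real.exp (-(V n * L))) ≤
      ENNReal.ofReal (Real.exp (-(V n * l))) := by
  have hbig : ∀ᶠ n in atTop, (m : ℝ) ≤ Real.exp (V n * (L - l)) :=
    (Real.tendsto_exp_atTop.comp (hV.atTop_mul_const (sub_pos.mpr hl))).eventually_ge_atTop _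
  filter_upwards [hbig] with n hn
  rw [← ENNReal.ofReal_natCast, ← ENNReal.ofReal_mul (Nat.cast_nonneg m)]
  refine ENNReal.ofReal_le_ofReal ?_
  calc (m : ℝ) * Real.exp (-(V n * L)) ≤ Real.exp (V n * (L - l)) * Real.exp (-(V n * L)) := by
        gcongr
    _ = Real.exp (-(V n * l)) := by rw [← Real.exp_add]; ring_nf

theorem exists_natCast_mul_bound_of_isCompact {K : Set E} (hK : IsCompact K) {r : ℕ → ℝ≥0∞}
    (hlocal : ∀ x ∈ K, ∃ U ∈ 𝓝 x, ∀ᶠ n in atTop, M n U ≤ r n) :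
    ∃ m : ℕ, ∀ᶠ n in atTop, M n K ≤ m * r n := by
  refine hK.induction_on (p := fun S => ∃ m : ℕ, ∀ᶠ n in atTop, M n S ≤ m * r n) ?_ ?_ ?_ ?_
  · exact ⟨0, Eventually.of_forall fun n => by simp⟩
  · rintro S T hST ⟨m, hm⟩
    exact ⟨m, hm.mono fun n hn => (measure_mono hST).trans hn⟩
  · rintro S T ⟨m, hm⟩ ⟨m', hm'⟩
    refine ⟨m + m', ?_⟩
    filter_upwards [hm, hm'] with n hn hn'
    rw [Nat.cast_add, add_mul]
    exact (measure_union_le _ _).trans (add_le_add hn hn')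
  · intro x hx
    obtain ⟨U, hU, hUn⟩ := hlocal x hx
    exact ⟨U, nhdsWithin_le_nhds hU, 1, by simpa using hUn⟩

theorem eventually_measure_isClosed_le (hV : Tendsto V atTop atTop)
    (htight : ∀ L : ℝ≥0, ∃ K : Set E, IsCompact K ∧
      ∀ᶠ n in atTop, M n Kᶜ ≤ ENNReal.ofReal (Real.exp (-(V n * L))))
    {A : Set E} (hA : IsClosed A) {l : ℝ} {L : ℝ≥0} (hl : l < L)
    (hlocal : ∀ x ∈ A, ∃ U ∈ 𝓝 x, ∀ᶠ n in atTop, M n U ≤ ENNReal.ofReal (Real.exp (-(V n * L)))) :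
    ∀ᶠ n in atTop, M n A ≤ ENNReal.ofReal (Real.exp (-(V n * l))) := by
  obtain ⟨K, hK, hKn⟩ := htight L
  obtain ⟨m, hm⟩ := exists_natCast_mul_bound_of_isCompact (hK.inter_left hA)
    fun x hx => hlocal x hx.1
  filter_upwards [hKn, hm, eventually_natCast_mul_exp_le hV (m + 1) hl] with n hKn hm hle
  calc M n A ≤ M n (A ∩ K) + M n Kᶜ := measure_le_inter_add_sdiff (M n) A K |>.trans <| by
        gcongr
        exact Set.sdiff_subset_compl A K
    _ ≤ m * ENNReal.ofReal (Real.exp (-(V n * L))) + ENNReal.ofReal (Real.exp (-(V n * L))) :=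
        add_le_add hm hKn
    _ = ((m + 1 : ℕ) : ℝ≥0∞) * ENNReal.ofReal (Real.exp (-(V n * L))) := by
        rw [Nat.cast_add, Nat.cast_one, add_mul, one_mul]
    _ ≤ ENNReal.ofReal (Real.exp (-(V n * l))) := hle

theorem satisfiesLDP_of_local_bounds (hM : ∀ n, M n Set.univ ≤ 1) (hV : Tendsto V atTop atTop)
    (hlsc : LowerSemicontinuous F) (hcompact : ∀ a : ℝ≥0, IsCompact {x | F x ≤ (a : ℝ≥0∞)})
    (hupper : ∀ (x : E) (L : ℝ≥0), L < F x →
      ∃ U ∈ 𝓝 x, ∀ᶠ n in atTop, M n U ≤ ENNReal.ofReal (Real.exp (-(V n * L))))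
    (htight : ∀ L : ℝ≥0, ∃ K : Set E, IsCompact K ∧
      ∀ᶠ n in atTop, M n Kᶜ ≤ ENNReal.ofReal (Real.exp (-(V n * L))))
    (hlower : ∀ (x : E) (L : ℝ≥0), F x < L → ∀ O : Set E, IsOpen O → x ∈ O →
      ∀ᶠ n in atTop, ENNReal.ofReal (Real.exp (-(V n * L))) ≤ M n O) :
    SatisfiesLDP M V F := by
  refine ⟨hV, hlsc, hcompact, fun A hA => ?_, fun O hO => ?_⟩
  · refine EReal.le_of_forall_lt_iff_le.1 fun z hz => limsup_le_of_le (by isBoundedDefault) ?_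
    rw [← neg_neg z, EReal.coe_neg, EReal.neg_lt_neg_iff] at hz
    suffices ∀ᶠ n in atTop, M n A ≤ ENNReal.ofReal (Real.exp (-(V n * -z))) by
      filter_upwards [this, hV.eventually_gt_atTop 0] with n hn hVn
      simpa using inv_mul_log_le hVn hn
    rcases lt_or_ge 0 z with hz0 | hz0
    · filter_upwards [hV.eventually_gt_atTop 0] with n hVn
      refine (measure_mono (Set.subset_univ A)).trans ((hM n).trans ?_)
      rw [ENNReal.one_le_ofReal, Real.one_le_exp_iff]
      nlinarith
    · obtain ⟨L, hzL, hL⟩ := EReal.lt_iff_exists_real_btwn.mp hz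
      rw [EReal.coe_lt_coe_iff] at hzL
      lift L to ℝ≥0 using by linarith
      refine eventually_measure_isClosed_le hV htight hA hzL fun x hx => hupper x L ?_
      exact EReal.coe_ennreal_lt_coe_ennreal_iff.mp (hL.trans_le (iInf₂_le x hx))
  · refine EReal.ge_of_forall_gt_iff_ge.1 fun z hz => le_liminf_of_le (by isBoundedDefault) ?_
    rw [← neg_neg z, EReal.coe_neg, EReal.neg_lt_neg_iff] at hz
    obtain ⟨x, hxO, hx⟩ : ∃ x ∈ O, (F x : EReal) < ((-z : ℝ) : EReal) := by
      simpa only [iInf_lt_iff, exists_prop] using hz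
    lift -z to ℝ≥0 using by exact_mod_cast (EReal.coe_ennreal_nonneg _).trans hx.le with L hL
    filter_upwards [hlower x L (EReal.coe_ennreal_lt_coe_ennreal_iff.mp hx) O hO hxO,
      hV.eventually_gt_atTop 0] with n hn hVn
    simpa [hL] using le_inv_mul_log hVn hn

theorem SatisfiesLDP.tendsto_log_univ (h : SatisfiesLDP M V F) :
    Tendsto (fun n => ((1 / V n : ℝ) : EReal) * ENNReal.log (M n Set.univ)) atTop
      (𝓝 (-((⨅ y, F y : ℝ≥0∞) : EReal))) := by
  have hcoe : ((⨅ y, F y : ℝ≥0∞) : EReal) = ⨅ x ∈ Set.univ, (F x : EReal) := by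
    rw [iInf_univ]
    exact Monotone.map_iInf_of_continuousAt continuous_coe_ennreal_ereal.continuousAt
      (fun _ _ => EReal.coe_ennreal_le_coe_ennreal_iff.mpr) EReal.coe_ennreal_top
  rw [hcoe]
  exact tendsto_of_le_liminf_of_limsup_le (h.lower_bound _ isOpen_univ)
    (h.upper_bound _ isClosed_univ)

theorem eventually_inv_mul_log_mul (hV : Tendsto V atTop atTop) (p q : ℕ → ℝ≥0∞) :
    ∀ᶠ n in atTop, ((1 / V n : ℝ) : EReal) * ENNReal.log (p n * q n) =
      ((1 / V n : ℝ) : EReal) * ENNReal.log (p n) +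
        ((1 / V n : ℝ) : EReal) * ENNReal.log (q n) := by
  filter_upwards [hV.eventually_gt_atTop 0] with n hVn
  rw [ENNReal.log_mul_add]
  exact EReal.left_distrib_of_nonneg_of_ne_top (by exact_mod_cast (one_div_pos.mpr hVn).le)
    (EReal.coe_ne_top _) _ _

theorem SatisfiesLDP.normalize (h : SatisfiesLDP M V F) (hF : ⨅ y, F y ≠ ⊤) :
    SatisfiesLDP (fun n => (M n Set.univ)⁻¹ • M n) V (fun x => F x - ⨅ y, F y) := by
  set I := ⨅ y, F y
  have hbot : (I : EReal) ≠ ⊥ := EReal.coe_ennreal_ne_bot I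
  have htop : (I : EReal) ≠ ⊤ := EReal.coe_ennreal_eq_top_iff.not.mpr hF
  have hneg (A : Set E) : -(⨅ x ∈ A, ((F x - I : ℝ≥0∞) : EReal)) =
      I + -(⨅ x ∈ A, (F x : EReal)) := by
    rw [iInf₂_coe_tsub hF (iInf_le F), EReal.neg_sub (.inr hbot) (.inr htop), add_comm]
  have hmass : Tendsto (fun n => ((1 / V n : ℝ) : EReal) * ENNReal.log (M n Set.univ)⁻¹) atTop
      (𝓝 (I : EReal)) := by
    have := (continuous_neg.tendsto _).comp h.tendsto_log_univ
    simpa only [ENNReal.log_inv, mul_neg, neg_neg, Function.comp_def] using this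
  have hlog (A : Set E) := eventually_inv_mul_log_mul h.speed_tendsto
    (fun n => (M n Set.univ)⁻¹) (fun n => M n A)
  have hsublevel (b : ℝ≥0∞) : {x | F x - I ≤ b} = {x | F x ≤ b + I} := by
    simp only [tsub_le_iff_right]
  refine ⟨h.speed_tendsto, ?_, fun a => ?_, fun A hA => ?_, fun O hO => ?_⟩
  · rw [lowerSemicontinuous_iff_isClosed_preimage]
    intro b
    change IsClosed {x | F x - I ≤ b}
    rw [hsublevel]
    exact h.lowerSemicontinuous.isClosed_preimage (b + I)
  · lift I to ℝ≥0 using hF with I'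
    rw [hsublevel]
    exact_mod_cast h.isCompact_sublevel (a + I')
  · rw [hneg]
    refine (limsup_congr (hlog A)).trans_le ?_
    refine (EReal.limsup_add_le (.inl ?_) (.inl ?_)).trans (add_le_add ?_ (h.upper_bound A hA)) <;>
      simp only [hmass.limsup_eq, ne_eq, hbot, htop, not_false_eq_true, le_refl]
  · rw [hneg]
    refine le_trans ?_ (EReal.le_liminf_add.trans_eq (liminf_congr (hlog O)).symm)
    rw [hmass.liminf_eq]
    gcongr
    exact h.lower_bound O hO

end Criteria

/-! ### Truncated moment generating functions -/

theorem abs_exp_sub_quadratic_le (y : ℝ) :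
    |Real.exp y - (1 + y + y ^ 2 / 2)| ≤ 3 * |y| ^ 3 * Real.exp (max y 0) := by
  have hexp : 1 ≤ Real.exp (max y 0) := Real.one_le_exp (le_max_right _ _)
  rcases le_total |y| 1 with hy1 | hy1
  · have htaylor := Real.exp_bound hy1 (n := 3) (by norm_num)
    norm_num [Finset.sum_range_succ, Nat.factorial] at htaylor
    refine htaylor.trans ?_
    nlinarith [pow_nonneg (abs_nonneg y) 3]
  · rcases le_total y 0 with hy0 | hy0
    · have hle : Real.exp y ≤ 1 := Real.exp_le_one_iff.mpr hy0
      have hpos := Real.exp_pos y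
      rw [abs_of_nonpos hy0] at hy1
      rw [max_eq_right hy0, Real.exp_zero, mul_one, abs_of_nonpos hy0, abs_le]
      have hsq : 1 ≤ y ^ 2 := by nlinarith
      constructor <;> nlinarith
    · have hquad := Real.quadratic_le_exp_of_nonneg hy0
      rw [abs_of_nonneg hy0] at hy1
      rw [max_eq_left hy0, abs_of_nonneg hy0, abs_of_nonneg (by linarith)]
      have hcube : 1 ≤ y ^ 3 := one_le_pow₀ hy1
      nlinarith [Real.exp_pos y]

theorem abs_tilt_le {θ x : ℝ} (hθ : |θ| ≤ 1) (hx : 0 ≤ x) (μ : ℝ) : |θ * (x - μ)| ≤ x + |μ| := by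
  have hsub := abs_sub x μ
  rw [abs_of_nonneg hx] at hsub
  rw [abs_mul]
  exact (mul_le_of_le_one_left (abs_nonneg _) hθ).trans hsub

theorem abs_exp_tilt_sub_quadratic_le {θ x a : ℝ} (hθ : |θ| ≤ 1) (hx : 0 ≤ x) (ha : 0 ≤ a)
    (hθx : θ * x ≤ a) (μ : ℝ) :
    |Real.exp (θ * (x - μ)) - (1 + θ * (x - μ) + (θ * (x - μ)) ^ 2 / 2)| ≤
      3 * Real.exp |μ| * ((x + |μ| + 1) ^ 5 * Real.exp a) * |θ| ^ 3 := by
  have hmax : max (θ * (x - μ)) 0 ≤ a + |μ| := by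
    have hθμ : -(θ * μ) ≤ |μ| := by
      rw [← neg_mul]
      refine (le_abs_self _).trans ?_
      rw [abs_mul, abs_neg]
      exact mul_le_of_le_one_left (abs_nonneg _) hθ
    exact max_le (by linarith) (by positivity)
  have hcube : |θ * (x - μ)| ^ 3 ≤ |θ| ^ 3 * (x + |μ| + 1) ^ 5 := by
    have hsub : |x - μ| ≤ x + |μ| + 1 := by
      have := abs_sub x μ
      rw [abs_of_nonneg hx] at this
      linarith
    rw [abs_mul, mul_pow]
    gcongr
    calc |x - μ| ^ 3 ≤ (x + |μ| + 1) ^ 3 := by gcongr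
      _ ≤ (x + |μ| + 1) ^ 5 := pow_le_pow_right₀ (by linarith [abs_nonneg μ]) (by norm_num)
  calc |Real.exp (θ * (x - μ)) - (1 + θ * (x - μ) + (θ * (x - μ)) ^ 2 / 2)|
      ≤ 3 * |θ * (x - μ)| ^ 3 * Real.exp (max (θ * (x - μ)) 0) := abs_exp_sub_quadratic_le _
    _ ≤ 3 * (|θ| ^ 3 * (x + |μ| + 1) ^ 5) * Real.exp (a + |μ|) := by gcongr
    _ = 3 * Real.exp |μ| * ((x + |μ| + 1) ^ 5 * Real.exp a) * |θ| ^ 3 := by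
        rw [Real.exp_add]; ring

theorem abs_quadratic_tilt_le {θ x B : ℝ} (hθ : |θ| ≤ 1) (hB : 0 < B) (hBx : B < x) (μ : ℝ) :
    |1 + θ * (x - μ) + (θ * (x - μ)) ^ 2 / 2| ≤ (x + |μ| + 1) ^ 5 * B⁻¹ ^ 3 := by
  have hx : 0 ≤ x := (hB.trans hBx).le
  have hμ := abs_nonneg μ
  have hquad : |1 + θ * (x - μ) + (θ * (x - μ)) ^ 2 / 2| ≤ (x + |μ| + 1) ^ 2 := by
    have hy := abs_le.mp (abs_tilt_le hθ hx μ)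
    have hy2 : (θ * (x - μ)) ^ 2 ≤ (x + |μ|) ^ 2 := sq_le_sq' hy.1 hy.2
    rw [abs_le]
    constructor <;> nlinarith
  have hone : 1 ≤ (x + |μ| + 1) ^ 3 * B⁻¹ ^ 3 := by
    rw [← mul_pow, ← div_eq_mul_inv]
    exact one_le_pow₀ ((one_le_div hB).mpr (by linarith))
  calc |1 + θ * (x - μ) + (θ * (x - μ)) ^ 2 / 2|
      ≤ (x + |μ| + 1) ^ 2 * ((x + |μ| + 1) ^ 3 * B⁻¹ ^ 3) :=
        hquad.trans (le_mul_of_one_le_right (by positivity) hone)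
    _ = (x + |μ| + 1) ^ 5 * B⁻¹ ^ 3 := by ring

/-- `p` is a probability mass function on `ℕ` with mean `μ` and variance `v`. -/
structure HasMeanVariance (p : ℕ → ℝ) (μ v : ℝ) : Prop where
  nonneg : ∀ k, 0 ≤ p k
  mass : HasSum p 1
  mean : HasSum (fun k => p k * (k - μ)) 0
  var : HasSum (fun k => p k * (k - μ) ^ 2) v

/-- The moment generating function at `θ` of the mass function `p` centred at `μ`, after its
restriction to `[0, B]`. -/
noncomputable def truncMGF (p : ℕ → ℝ) (μ B θ : ℝ) : ℝ :=
  ∑' k : ℕ, if (k : ℝ) ≤ B then p k * Real.exp (θ * (k - μ)) else 0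

section TruncMGF

variable {p : ℕ → ℝ} {μ v : ℝ}

theorem summable_truncMGF (p : ℕ → ℝ) (μ B θ : ℝ) :
    Summable fun k : ℕ => if (k : ℝ) ≤ B then p k * Real.exp (θ * (k - μ)) else 0 := by
  refine summable_of_ne_finset_zero (s := Finset.range (⌊B⌋₊ + 1)) fun k hk => if_neg fun hkB => ?_
  exact hk (Finset.mem_range_succ_iff.mpr (Nat.le_floor hkB))

theorem truncMGF_pos {B : ℝ} (hp : ∀ k, 0 ≤ p k) (hp0 : 0 < p 0) (hB : 0 ≤ B) (θ : ℝ) :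
    0 < truncMGF p μ B θ := by
  refine (summable_truncMGF p μ B θ).tsum_pos (fun k => ?_) 0 ?_
  · split_ifs
    · exact mul_nonneg (hp k) (Real.exp_pos _).le
    · rfl
  · rw [if_pos (by simpa using hB)]
    positivity

theorem HasMeanVariance.hasSum_quadratic (h : HasMeanVariance p μ v) (θ : ℝ) :
    HasSum (fun k : ℕ => p k * (1 + θ * (k - μ) + (θ * (k - μ)) ^ 2 / 2)) (1 + θ ^ 2 * v / 2) := by
  convert (h.mass.add (h.mean.mul_left θ)).add (h.var.mul_left (θ ^ 2 / 2)) using 1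
  · ext k; ring
  · ring

theorem HasMeanVariance.abs_truncMGF_sub_le (h : HasMeanVariance p μ v) {w : ℕ → ℝ}
    (hw : ∀ k, 0 ≤ w k) (hsum : Summable fun k : ℕ => p k * ((k + |μ| + 1) ^ 5 * Real.exp (w k)))
    {θ B : ℝ} (hθ : |θ| ≤ 1) (hB : 0 < B) (hle : ∀ k : ℕ, (k : ℝ) ≤ B → θ * k ≤ w k) :
    |truncMGF p μ B θ - (1 + θ ^ 2 * v / 2)| ≤ (3 * Real.exp |μ| + 1) *
      (∑' k : ℕ, p k * ((k + |μ| + 1) ^ 5 * Real.exp (w k))) * (|θ| ^ 3 + B⁻¹ ^ 3) := by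
  have hdiff := (summable_truncMGF p μ B θ).hasSum.sub (h.hasSum_quadratic θ)
  have hmajorant := (hsum.hasSum.mul_left (3 * Real.exp |μ| + 1)).mul_right (|θ| ^ 3 + B⁻¹ ^ 3)
  rw [truncMGF, ← hdiff.tsum_eq, ← Real.norm_eq_abs]
  refine tsum_of_norm_bounded hmajorant fun k => ?_
  have hpk := h.nonneg k
  rw [Real.norm_eq_abs]
  split_ifs with hkB
  · rw [← mul_sub, abs_mul, abs_of_nonneg hpk]
    calc p k * |Real.exp (θ * (k - μ)) - (1 + θ * (k - μ) + (θ * (k - μ)) ^ 2 / 2)|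
        ≤ p k * (3 * Real.exp |μ| * (((k : ℝ) + |μ| + 1) ^ 5 * Real.exp (w k)) * |θ| ^ 3) := by
          gcongr
          exact abs_exp_tilt_sub_quadratic_le hθ k.cast_nonneg (hw k) (hle k hkB) μ
      _ = 3 * Real.exp |μ| * (p k * (((k : ℝ) + |μ| + 1) ^ 5 * Real.exp (w k))) * |θ| ^ 3 := by ring
      _ ≤ _ := by
          gcongr
          · exact le_add_of_nonneg_right zero_le_one
          · exact le_add_of_nonneg_right (by positivity)
  · rw [zero_sub, abs_neg, abs_mul, abs_of_nonneg hpk]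
    calc p k * |1 + θ * (k - μ) + (θ * (k - μ)) ^ 2 / 2|
        ≤ p k * (((k : ℝ) + |μ| + 1) ^ 5 * B⁻¹ ^ 3) := by
          gcongr
          exact abs_quadratic_tilt_le hθ hB (not_le.mp hkB) μ
      _ = 1 * (p k * (((k : ℝ) + |μ| + 1) ^ 5 * 1)) * B⁻¹ ^ 3 := by ring
      _ ≤ _ := by
          gcongr
          · exact le_add_of_nonneg_left (by positivity)
          · exact Real.one_le_exp (hw k)
          · exact le_add_of_nonneg_left (by positivity)

end TruncMGF

/-! ### Stretched exponential laws and their scales -/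

theorem summable_add_pow_mul_exp_neg_rpow {α κ : ℝ} (hα : 0 < α) (hκ : 0 < κ) (m : ℝ) (j : ℕ) :
    Summable fun k : ℕ => ((k : ℝ) + m) ^ j * Real.exp (-κ * (k : ℝ) ^ α) := by
  have hpow : Tendsto (fun k : ℕ => (k : ℝ) ^ α) atTop atTop :=
    (tendsto_rpow_atTop hα).comp tendsto_natCast_atTop_atTop
  have hexp := ((isLittleO_exp_neg_mul_rpow_atTop hκ (-((j : ℝ) + 2) / α)).comp_tendsto hpow).isBigO
  have hpoly : (fun k : ℕ => ((k : ℝ) + m) ^ j) =O[atTop] fun k : ℕ => (k : ℝ) ^ j :=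
    ((Asymptotics.isBigO_refl _ _).add ((Asymptotics.isLittleO_const_id_atTop m).comp_tendsto
      tendsto_natCast_atTop_atTop).isBigO).pow j
  refine summable_of_isBigO_nat (Real.summable_one_div_nat_rpow.mpr (by norm_num : (1 : ℝ) < 2))
    ((hpoly.mul hexp).trans (Asymptotics.IsBigO.of_bound 1 ?_))
  filter_upwards [eventually_gt_atTop 0] with k hk
  have hk' : (0 : ℝ) < k := by exact_mod_cast hk
  rw [Function.comp_apply, ← Real.rpow_mul hk'.le, mul_div_cancel₀ _ hα.ne', ← Real.rpow_natCast,
    ← Real.rpow_add hk', one_mul, one_div, ← Real.rpow_neg hk'.le]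
  ring_nf
  rfl

/-- The stretched exponential weights `c e ^ (-k ^ α)` on `ℕ`. -/
noncomputable def stretchedExp (c α : ℝ) (k : ℕ) : ℝ := c * Real.exp (-(k : ℝ) ^ α)

/-- The weights `c e ^ (-k ^ α)` with `0 < α < 1` form a nondegenerate law on `ℕ` with mean `μ` and
variance `v`. -/
structure IsStretchedExpLaw (α c μ v : ℝ) : Prop
    extends HasMeanVariance (stretchedExp c α) μ v where
  alpha_pos : 0 < α
  alpha_lt_one : α < 1
  c_pos : 0 < c
  var_pos : 0 < v

theorem IsStretchedExpLaw.stretchedExp_pos {α c μ v : ℝ} (h : IsStretchedExpLaw α c μ v) (k : ℕ) :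
    0 < stretchedExp c α k :=
  mul_pos h.c_pos (Real.exp_pos _)

section Scales

variable {α γ : ℝ}

theorem gamma_pos (hα1 : α < 1) (hγ : γ = 1 / (2 - α)) : 0 < γ := by
  rw [hγ]
  exact one_div_pos.mpr (by linarith)

theorem gamma_lt_one (hα1 : α < 1) (hγ : γ = 1 / (2 - α)) : γ < 1 := by
  rw [hγ, div_lt_one] <;> linarith

theorem natCast_rpow_rpow (n : ℕ) : ((n : ℝ) ^ γ) ^ α = (n : ℝ) ^ (γ * α) :=
  (Real.rpow_mul (Nat.cast_nonneg n) γ α).symm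

theorem scale_mul_self (hα1 : α < 1) (hγ : γ = 1 / (2 - α)) {n : ℕ} (hn : 0 < n) :
    (n : ℝ) ^ γ * (n : ℝ) ^ γ = n * (n : ℝ) ^ (γ * α) := by
  have hn' : (0 : ℝ) < n := by exact_mod_cast hn
  have hexponent : γ + γ = 1 + γ * α := by
    have : 2 - α ≠ 0 := by linarith
    rw [hγ]
    field_simp
    ring
  rw [← Real.rpow_add hn', hexponent, Real.rpow_add hn', Real.rpow_one]

theorem tendsto_scale (hα1 : α < 1) (hγ : γ = 1 / (2 - α)) :
    Tendsto (fun n : ℕ => (n : ℝ) ^ γ) atTop atTop :=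
  (tendsto_rpow_atTop (gamma_pos hα1 hγ)).comp tendsto_natCast_atTop_atTop

theorem tendsto_speed (hα0 : 0 < α) (hα1 : α < 1) (hγ : γ = 1 / (2 - α)) :
    Tendsto (fun n : ℕ => (n : ℝ) ^ (γ * α)) atTop atTop :=
  (tendsto_rpow_atTop (mul_pos (gamma_pos hα1 hγ) hα0)).comp tendsto_natCast_atTop_atTop

theorem tendsto_scale_div (hα1 : α < 1) (hγ : γ = 1 / (2 - α)) :
    Tendsto (fun n : ℕ => (n : ℝ) ^ γ / n) atTop (𝓝 0) := by
  have hneg : Tendsto (fun n : ℕ => (n : ℝ) ^ (-(1 - γ))) atTop (𝓝 0) :=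
    (tendsto_rpow_neg_atTop (by linarith [gamma_lt_one hα1 hγ])).comp tendsto_natCast_atTop_atTop
  refine hneg.congr' ?_
  filter_upwards [eventually_gt_atTop 0] with n hn
  have hn' : (0 : ℝ) < n := by exact_mod_cast hn
  rw [neg_sub, Real.rpow_sub_one hn'.ne']

theorem tendsto_speed_div (hα1 : α < 1) (hγ : γ = 1 / (2 - α)) :
    Tendsto (fun n : ℕ => (n : ℝ) ^ (γ * α) / n) atTop (𝓝 0) := by
  have hsq := (tendsto_scale_div hα1 hγ).pow 2
  rw [zero_pow two_ne_zero] at hsq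
  refine hsq.congr' ?_
  filter_upwards [eventually_gt_atTop 0] with n hn
  have : (0 : ℝ) < n := by exact_mod_cast hn
  rw [div_pow, pow_two ((n : ℝ) ^ γ), scale_mul_self hα1 hγ hn]
  field_simp

theorem tendsto_log_div_speed (hα0 : 0 < α) (hα1 : α < 1) (hγ : γ = 1 / (2 - α)) :
    Tendsto (fun n : ℕ => Real.log n / (n : ℝ) ^ (γ * α)) atTop (𝓝 0) :=
  ((isLittleO_log_rpow_atTop (mul_pos (gamma_pos hα1 hγ) hα0)).tendsto_div_nhds_zero).comp
    tendsto_natCast_atTop_atTop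

theorem mul_le_mul_rpow_of_le {t b y z : ℝ} (hα1 : α < 1) (hb : 0 ≤ b) (hy : 0 ≤ y) (hyz : y ≤ z)
    (ht : t * z ^ (1 - α) ≤ b) : t * y ≤ b * y ^ α := by
  rcases hy.eq_or_lt with rfl | hy
  · rw [mul_zero]
    positivity
  rcases le_total t 0 with ht0 | ht0
  · exact (mul_nonpos_of_nonpos_of_nonneg ht0 hy.le).trans (by positivity)
  have hsplit : y = y ^ (1 - α) * y ^ α := by rw [← Real.rpow_add hy]; simp
  calc t * y = t * y ^ (1 - α) * y ^ α := by rw [mul_assoc, ← hsplit]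
    _ ≤ t * z ^ (1 - α) * y ^ α := by
        have : 0 ≤ 1 - α := by linarith
        gcongr
    _ ≤ b * y ^ α := by gcongr

theorem tilt_mul_le (hα1 : α < 1) (hγ : γ = 1 / (2 - α)) {η t : ℝ} (hη : 0 ≤ η)
    (ht : t * η ^ (1 - α) ≤ 1 / 2) {n : ℕ} (hn : 0 < n) {x : ℝ} (hx : 0 ≤ x)
    (hxη : x ≤ η * (n : ℝ) ^ γ) : t * ((n : ℝ) ^ γ / n) * x ≤ 1 / 2 * x ^ α := by
  refine mul_le_mul_rpow_of_le hα1 (by norm_num) hx hxη (le_of_eq_of_le ?_ ht)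
  have : (0 : ℝ) < n := by exact_mod_cast hn
  have hsq := scale_mul_self hα1 hγ hn
  rw [← natCast_rpow_rpow] at hsq
  set r := (n : ℝ) ^ γ
  have hr : 0 < r := by positivity
  have hone : r / n * r ^ (1 - α) = 1 := by
    rw [Real.rpow_sub hr, Real.rpow_one, div_mul_div_comm, hsq]
    exact div_self (by positivity)
  calc t * (r / n) * (η * r) ^ (1 - α) = t * η ^ (1 - α) * (r / n * r ^ (1 - α)) := by
        rw [Real.mul_rpow hη hr.le]; ring
    _ = t * η ^ (1 - α) := by rw [hone, mul_one]

end Scales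

theorem tendsto_natCast_sub_div (K : ℕ) :
    Tendsto (fun n : ℕ => ((n - K : ℕ) : ℝ) / n) atTop (𝓝 1) := by
  have hlim : Tendsto (fun n : ℕ => 1 - (K : ℝ) / n) atTop (𝓝 (1 - 0)) :=
    tendsto_const_nhds.sub (tendsto_const_div_atTop_nhds_zero_nat _)
  rw [sub_zero] at hlim
  refine hlim.congr' ?_
  filter_upwards [eventually_gt_atTop 0, eventually_ge_atTop K] with n hn hK
  have : (0 : ℝ) < n := by exact_mod_cast hn
  rw [Nat.cast_sub hK]
  field_simp

theorem tendsto_mul_log_of_tendsto_mul_sub_one {a φ : ℕ → ℝ} {l : ℝ} (ha : ∀ n, 0 ≤ a n)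
    (hφ : ∀ n, 0 < φ n) (hφ1 : Tendsto φ atTop (𝓝 1))
    (hlim : Tendsto (fun n => a n * (φ n - 1)) atTop (𝓝 l)) :
    Tendsto (fun n => a n * Real.log (φ n)) atTop (𝓝 l) := by
  have hlower : Tendsto (fun n => a n * (φ n - 1) * (φ n)⁻¹) atTop (𝓝 l) := by
    simpa using hlim.mul (hφ1.inv₀ one_ne_zero)
  refine tendsto_of_tendsto_of_tendsto_of_le_of_le hlower hlim (fun n => ?_) fun n => ?_
  · calc a n * (φ n - 1) * (φ n)⁻¹ = a n * (1 - (φ n)⁻¹) := by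
          rw [mul_assoc, sub_mul, mul_inv_cancel₀ (hφ n).ne', one_mul]
      _ ≤ a n * Real.log (φ n) :=
          mul_le_mul_of_nonneg_left (Real.one_sub_inv_le_log_of_pos (hφ n)) (ha n)
  · exact mul_le_mul_of_nonneg_left (Real.log_le_sub_one_of_pos (hφ n)) (ha n)

section TiltedLaw

variable {α c μ v γ η t : ℝ}

theorem IsStretchedExpLaw.exists_abs_truncMGF_sub_le (h : IsStretchedExpLaw α c μ v) :
    ∃ C : ℝ, ∀ θ B : ℝ, |θ| ≤ 1 → 0 < B →
      (∀ k : ℕ, (k : ℝ) ≤ B → θ * k ≤ 1 / 2 * (k : ℝ) ^ α) →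
      |truncMGF (stretchedExp c α) μ B θ - (1 + θ ^ 2 * v / 2)| ≤ C * (|θ| ^ 3 + B⁻¹ ^ 3) := by
  have hsum : Summable fun k : ℕ => stretchedExp c α k *
      (((k : ℝ) + |μ| + 1) ^ 5 * Real.exp (1 / 2 * (k : ℝ) ^ α)) := by
    refine ((summable_add_pow_mul_exp_neg_rpow h.alpha_pos (κ := 1 / 2) (by norm_num)
      (|μ| + 1) 5).mul_left c).congr fun k => ?_
    have hexp : Real.exp (-(1 / 2) * (k : ℝ) ^ α) =
        Real.exp (-(k : ℝ) ^ α) * Real.exp (1 / 2 * (k : ℝ) ^ α) := by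
      rw [← Real.exp_add]; ring_nf
    rw [stretchedExp, hexp]
    ring
  exact ⟨_, fun θ B hθ hB hle =>
    h.abs_truncMGF_sub_le (fun k => by positivity) hsum hθ hB hle⟩

theorem IsStretchedExpLaw.tendsto_mul_truncMGF_sub_one (h : IsStretchedExpLaw α c μ v)
    (hγ : γ = 1 / (2 - α)) (hη : 0 < η) (ht : t * η ^ (1 - α) ≤ 1 / 2) :
    Tendsto (fun n : ℕ => (n : ℝ) / (n : ℝ) ^ (γ * α) *
      (truncMGF (stretchedExp c α) μ (η * (n : ℝ) ^ γ) (t * ((n : ℝ) ^ γ / n)) - 1)) atTop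
      (𝓝 (t ^ 2 * v / 2)) := by
  obtain ⟨C, hC⟩ := h.exists_abs_truncMGF_sub_le
  have hα1 := h.alpha_lt_one
  have hrn := tendsto_scale_div hα1 hγ
  have herr : Tendsto (fun n : ℕ => C * (|t| ^ 3 * ((n : ℝ) ^ γ / n) +
      η⁻¹ ^ 3 * (((n : ℝ) ^ (γ * α))⁻¹ ^ 2 * ((n : ℝ) ^ γ)⁻¹))) atTop (𝓝 0) := by
    have hlim := ((hrn.const_mul (|t| ^ 3)).add
      ((((tendsto_speed h.alpha_pos hα1 hγ).inv_tendsto_atTop.pow 2).mul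
        (tendsto_scale hα1 hγ).inv_tendsto_atTop).const_mul (η⁻¹ ^ 3))).const_mul C
    rw [zero_pow two_ne_zero, mul_zero, mul_zero, mul_zero, add_zero, mul_zero] at hlim
    exact hlim
  have hsmall : ∀ᶠ n : ℕ in atTop, |t * ((n : ℝ) ^ γ / n)| ≤ 1 :=
    (by simpa using (hrn.const_mul t).abs : Tendsto _ atTop (𝓝 (0 : ℝ))).eventually_le_const one_pos
  rw [tendsto_iff_norm_sub_tendsto_zero]
  refine squeeze_zero' (Eventually.of_forall fun _ => norm_nonneg _) ?_ herr
  filter_upwards [hsmall, eventually_gt_atTop 0] with n hn hn0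
  have : (0 : ℝ) < n := by exact_mod_cast hn0
  have hbound := hC _ (η * (n : ℝ) ^ γ) hn (by positivity) fun k hk =>
    tilt_mul_le hα1 hγ hη.le ht hn0 k.cast_nonneg hk
  have hspeed : (n : ℝ) ^ (γ * α) = (n : ℝ) ^ γ * (n : ℝ) ^ γ / n := by
    rw [scale_mul_self hα1 hγ hn0]; field_simp
  have hr : 0 < (n : ℝ) ^ γ := by positivity
  rw [hspeed]
  set r := (n : ℝ) ^ γ
  set φ := truncMGF (stretchedExp c α) μ (η * r) (t * (r / n))
  have hcenter : (n : ℝ) / (r * r / n) * (φ - 1) - t ^ 2 * v / 2 =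
      (n : ℝ) / (r * r / n) * (φ - (1 + (t * (r / n)) ^ 2 * v / 2)) := by
    field_simp
    ring
  rw [hcenter, Real.norm_eq_abs, abs_mul, abs_of_pos (by positivity : 0 < (n : ℝ) / (r * r / n))]
  refine (mul_le_mul_of_nonneg_left hbound (by positivity)).trans (le_of_eq ?_)
  rw [abs_mul, abs_of_pos (by positivity : 0 < r / n)]
  field_simp

theorem IsStretchedExpLaw.tendsto_truncMGF (h : IsStretchedExpLaw α c μ v)
    (hγ : γ = 1 / (2 - α)) (hη : 0 < η) (ht : t * η ^ (1 - α) ≤ 1 / 2) :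
    Tendsto (fun n : ℕ =>
      truncMGF (stretchedExp c α) μ (η * (n : ℝ) ^ γ) (t * ((n : ℝ) ^ γ / n))) atTop (𝓝 1) := by
  have hlim := ((tendsto_speed_div h.alpha_lt_one hγ).mul
    (h.tendsto_mul_truncMGF_sub_one hγ hη ht)).add_const 1
  rw [zero_mul, zero_add] at hlim
  refine hlim.congr' ?_
  filter_upwards [eventually_gt_atTop 0] with n hn
  have : (0 : ℝ) < n := by exact_mod_cast hn
  field_simp
  ring

theorem IsStretchedExpLaw.tendsto_log_truncMGF (h : IsStretchedExpLaw α c μ v)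
    (hγ : γ = 1 / (2 - α)) (hη : 0 < η) (ht : t * η ^ (1 - α) ≤ 1 / 2) (K : ℕ) :
    Tendsto (fun n : ℕ => ((n - K : ℕ) : ℝ) / (n : ℝ) ^ (γ * α) *
      Real.log (truncMGF (stretchedExp c α) μ (η * (n : ℝ) ^ γ) (t * ((n : ℝ) ^ γ / n)))) atTop
      (𝓝 (t ^ 2 * v / 2)) := by
  have hlog := tendsto_mul_log_of_tendsto_mul_sub_one
    (fun n : ℕ => (by positivity : (0 : ℝ) ≤ (n : ℝ) / (n : ℝ) ^ (γ * α)))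
    (fun n : ℕ => truncMGF_pos h.nonneg (h.stretchedExp_pos 0) (by positivity) _)
    (h.tendsto_truncMGF hγ hη ht) (h.tendsto_mul_truncMGF_sub_one hγ hη ht)
  have hlim := (tendsto_natCast_sub_div K).mul hlog
  rw [one_mul] at hlim
  refine hlim.congr' ?_
  filter_upwards [eventually_gt_atTop 0] with n hn
  have : (0 : ℝ) < n := by exact_mod_cast hn
  rw [← mul_assoc]
  field_simp

end TiltedLaw

/-! ### Independent integer-valued variables -/

section FiniteDependence

theorem exists_preimage_of_dependsOn {Ω ι : Type*} {J : Finset ι} {q : (ι → ℕ) → Prop}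
    (hq : DependsOn q J) (X : ι → Ω → ℕ) :
    ∃ A : Set (J → ℕ), {ω | q fun i => X i ω} = (fun ω (i : J) => X i ω) ⁻¹' A := by
  obtain ⟨g, rfl⟩ := dependsOn_iff_exists_comp.mp hq
  exact ⟨{y | g y}, rfl⟩

variable {Ω ι : Type*} [MeasurableSpace Ω] {P : Measure Ω} {X : ι → Ω → ℕ}

theorem measurableSet_of_dependsOn (hX : ∀ i, Measurable (X i)) {J : Finset ι}
    {q : (ι → ℕ) → Prop} (hq : DependsOn q J) : MeasurableSet {ω | q fun i => X i ω} := by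
  obtain ⟨A, hA⟩ := exists_preimage_of_dependsOn hq X
  rw [hA]
  exact measurable_pi_lambda _ (fun i : J => hX i) A.to_countable.measurableSet

theorem measure_and_eq_mul_of_dependsOn (hX : ∀ i, Measurable (X i)) (hindep : iIndepFun X P)
    {J R : Finset ι} (hJR : Disjoint J R) {q₁ q₂ : (ι → ℕ) → Prop} (hq₁ : DependsOn q₁ J)
    (hq₂ : DependsOn q₂ R) :
    P {ω | (q₁ fun i => X i ω) ∧ q₂ fun i => X i ω} =
      P {ω | q₁ fun i => X i ω} * P {ω | q₂ fun i => X i ω} := by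
  obtain ⟨A, hA⟩ := exists_preimage_of_dependsOn hq₁ X
  obtain ⟨B, hB⟩ := exists_preimage_of_dependsOn hq₂ X
  rw [Set.ofPred_and, hA, hB]
  exact (hindep.indepFun_finset J R hJR hX).measure_inter_preimage_eq_mul A B
    A.to_countable.measurableSet B.to_countable.measurableSet

theorem measure_forall_mem_eq_prod (hindep : iIndepFun X P) (J : Finset ι) (A : ι → Set ℕ) :
    P {ω | ∀ i ∈ J, X i ω ∈ A i} = ∏ i ∈ J, P {ω | X i ω ∈ A i} := by
  have hset : {ω | ∀ i ∈ J, X i ω ∈ A i} = ⋂ i ∈ J, X i ⁻¹' A i := by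
    ext ω
    simp only [Set.mem_ofPred_eq, Set.mem_iInter, Set.mem_preimage]
  rw [hset]
  exact hindep.measure_inter_preimage_eq_mul J fun i _ => (A i).to_countable.measurableSet

theorem dependsOn_forall_mem (J : Finset ι) (A : ι → Set ℕ) :
    DependsOn (fun x : ι → ℕ => ∀ i ∈ J, x i ∈ A i) J := fun x y hxy =>
  propext (forall₂_congr fun i hi => by rw [hxy i hi])

theorem mul_measure_le_measure_and_eq (hX : ∀ i, Measurable (X i)) (hindep : iIndepFun X P)
    {i₀ : ι} {R : Finset ι} (hi₀ : i₀ ∉ R) {q : (ι → ℕ) → Prop} (hq : DependsOn q R)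
    {f : (ι → ℕ) → ℕ} (hf : DependsOn f R) {D : ℕ} (hfD : ∀ x, q x → f x ≤ D) {m : ℝ≥0∞}
    (hm : ∀ d ≤ D, m ≤ P {ω | X i₀ ω = d}) :
    m * P {ω | q fun i => X i ω} ≤
      P {ω | (q fun i => X i ω) ∧ X i₀ ω = f fun i => X i ω} := by
  have hqf (d : ℕ) : DependsOn (fun x => q x ∧ f x = d) R := fun x y hxy => by
    simp only [hq hxy, hf hxy]
  have hdisj : Disjoint {i₀} R := Finset.disjoint_singleton_left.mpr hi₀
  have hone (d : ℕ) : DependsOn (fun x : ι → ℕ => x i₀ = d) (({i₀} : Finset ι) : Set ι) :=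
    fun x y hxy => by simp only [hxy i₀ (by simp)]
  have hmul (d : ℕ) := measure_and_eq_mul_of_dependsOn hX hindep hdisj (hone d) (hqf d)
  calc m * P {ω | q fun i => X i ω}
      ≤ m * ∑ d ∈ Finset.range (D + 1), P {ω | (q fun i => X i ω) ∧ (f fun i => X i ω) = d} := by
        gcongr
        refine (measure_mono fun ω hω => ?_).trans (measure_biUnion_finset_le _ _)
        exact Set.mem_iUnion₂.mpr ⟨_, Finset.mem_range_succ_iff.mpr (hfD _ hω), hω, rfl⟩
    _ ≤ ∑ d ∈ Finset.range (D + 1),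
          P {ω | X i₀ ω = d ∧ (q fun i => X i ω) ∧ (f fun i => X i ω) = d} := by
        rw [Finset.mul_sum]
        refine Finset.sum_le_sum fun d hd => ?_
        rw [hmul]
        gcongr
        exact hm d (Finset.mem_range_succ_iff.mp hd)
    _ = P (⋃ d ∈ Finset.range (D + 1),
          {ω | X i₀ ω = d ∧ (q fun i => X i ω) ∧ (f fun i => X i ω) = d}) := by
        refine (measure_biUnion_finset (fun d _ d' _ hne => ?_) fun d _ => ?_).symm
        · exact Set.disjoint_left.mpr fun ω hω hω' => hne (hω.1.symm.trans hω'.1)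
        · exact (hX i₀ (measurableSet_singleton d)).inter (measurableSet_of_dependsOn hX (hqf d))
    _ ≤ _ := by
        refine measure_mono (Set.iUnion₂_subset fun d _ ω hω => ?_)
        exact ⟨hω.2.1, hω.1.trans hω.2.2.symm⟩

end FiniteDependence

/-- Under `P`, the variables `X i` are independent with common probability mass function `p`. -/
structure IsIIDWithMass {Ω : Type*} [MeasurableSpace Ω] (P : Measure Ω) (X : ℕ → Ω → ℕ)
    (p : ℕ → ℝ) : Prop where
  measurable : ∀ i, Measurable (X i)
  indep : iIndepFun X P
  nonneg : ∀ k, 0 ≤ p k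
  law : ∀ i k, P {ω | X i ω = k} = ENNReal.ofReal (p k)

/-- The factor `1_{k ≤ B} e ^ (θ (k - μ))` by which tilting multiplies the mass at `k`; its
expectation is `truncMGF`. -/
noncomputable def tiltWeight (μ B θ : ℝ) (k : ℕ) : ℝ≥0∞ :=
  if (k : ℝ) ≤ B then ENNReal.ofReal (Real.exp (θ * (k - μ))) else 0

theorem dependsOn_forall_le_and_sum (R : Finset ℕ) (μ B : ℝ) (q : ℝ → Prop) :
    DependsOn (fun x : ℕ → ℕ => (∀ i ∈ R, (x i : ℝ) ≤ B) ∧ q (∑ i ∈ R, ((x i : ℝ) - μ))) R :=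
  fun x y hxy => by
    have hsum : ∑ i ∈ R, ((x i : ℝ) - μ) = ∑ i ∈ R, ((y i : ℝ) - μ) :=
      Finset.sum_congr rfl fun i hi => by rw [hxy i hi]
    have hle : (∀ i ∈ R, (x i : ℝ) ≤ B) = ∀ i ∈ R, (y i : ℝ) ≤ B :=
      propext (forall₂_congr fun i hi => by rw [hxy i hi])
    simp only [hsum, hle]

/-- The configurations whose coordinates in `R` are at most `B` and have a centred sum in
`[a, b]`. -/
def truncWindow (R : Finset ℕ) (μ B a b : ℝ) : Set (ℕ → ℕ) :=
  {x | (∀ i ∈ R, (x i : ℝ) ≤ B) ∧ ∑ i ∈ R, ((x i : ℝ) - μ) ∈ Set.Icc a b}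

theorem dependsOn_mem_truncWindow (R : Finset ℕ) (μ B a b : ℝ) :
    DependsOn (fun x => x ∈ truncWindow R μ B a b) R :=
  dependsOn_forall_le_and_sum R μ B (· ∈ Set.Icc a b)

theorem prod_tiltWeight (x : ℕ → ℕ) (μ B θ : ℝ) (R : Finset ℕ) :
    ∏ i ∈ R, tiltWeight μ B θ (x i) = if ∀ i ∈ R, (x i : ℝ) ≤ B then
      ENNReal.ofReal (Real.exp (θ * ∑ i ∈ R, ((x i : ℝ) - μ))) else 0 := by
  split_ifs with h
  · rw [Finset.mul_sum, Real.exp_sum, ENNReal.ofReal_prod_of_nonneg fun i _ => (Real.exp_pos _).le]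
    exact Finset.prod_congr rfl fun i hi => if_pos (h i hi)
  · push Not at h
    obtain ⟨i, hi, hlt⟩ := h
    exact Finset.prod_eq_zero hi (if_neg (not_le.mpr hlt))

theorem prod_tiltWeight_le (x : ℕ → ℕ) (μ B : ℝ) {θ τ w a b : ℝ} (hτ : 0 ≤ τ)
    (hw : ∀ z ∈ Set.Icc a b, θ * z ≤ w) (R : Finset ℕ) :
    ∏ i ∈ R, tiltWeight μ B θ (x i) ≤
      ENNReal.ofReal (Real.exp w) * (truncWindow R μ B a b).indicator 1 x +
      ENNReal.ofReal (Real.exp (-(τ * b))) * ∏ i ∈ R, tiltWeight μ B (θ + τ) (x i) +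
      ENNReal.ofReal (Real.exp (τ * a)) * ∏ i ∈ R, tiltWeight μ B (θ - τ) (x i) := by
  simp only [prod_tiltWeight]
  split_ifs with hB
  swap
  · exact zero_le
  simp only [← ENNReal.ofReal_mul (Real.exp_pos _).le, ← Real.exp_add]
  rcases lt_or_ge (∑ i ∈ R, ((x i : ℝ) - μ)) a with hza | hza
  · refine le_add_left (ENNReal.ofReal_le_ofReal (Real.exp_le_exp.mpr ?_))
    nlinarith
  rcases lt_or_ge b (∑ i ∈ R, ((x i : ℝ) - μ)) with hzb | hzb
  · refine le_add_right (le_add_left (ENNReal.ofReal_le_ofReal (Real.exp_le_exp.mpr ?_)))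
    nlinarith
  · have hx : x ∈ truncWindow R μ B a b := ⟨hB, hza, hzb⟩
    rw [Set.indicator_of_mem hx, Pi.one_apply, mul_one]
    exact le_add_right (le_add_right (ENNReal.ofReal_le_ofReal
      (Real.exp_le_exp.mpr (hw _ ⟨hza, hzb⟩))))

section IID

variable {Ω : Type*} [MeasurableSpace Ω] {P : Measure Ω} {X : ℕ → Ω → ℕ} {p : ℕ → ℝ}

theorem truncMGF_nonneg (hp : ∀ k, 0 ≤ p k) (μ B θ : ℝ) : 0 ≤ truncMGF p μ B θ :=
  tsum_nonneg fun k => by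
    split_ifs
    · exact mul_nonneg (hp k) (Real.exp_pos _).le
    · rfl

theorem IsIIDWithMass.lintegral_comp (h : IsIIDWithMass P X p) (g : ℕ → ℝ≥0∞) (i : ℕ) :
    ∫⁻ ω, g (X i ω) ∂P = ∑' k : ℕ, g k * ENNReal.ofReal (p k) := by
  rw [← lintegral_map (measurable_of_countable g) (h.measurable i), lintegral_countable']
  refine tsum_congr fun k => ?_
  rw [Measure.map_apply (h.measurable i) (measurableSet_singleton k), ← h.law i k]
  rfl

theorem IsIIDWithMass.lintegral_tiltWeight (h : IsIIDWithMass P X p) (μ B θ : ℝ) (i : ℕ) :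
    ∫⁻ ω, tiltWeight μ B θ (X i ω) ∂P = ENNReal.ofReal (truncMGF p μ B θ) := by
  rw [h.lintegral_comp, truncMGF, ENNReal.ofReal_tsum_of_nonneg _ (summable_truncMGF p μ B θ)]
  · refine tsum_congr fun k => ?_
    rw [tiltWeight]
    split_ifs
    · rw [← ENNReal.ofReal_mul (Real.exp_pos _).le, mul_comm]
    · simp
  · intro k
    split_ifs
    · exact mul_nonneg (h.nonneg k) (Real.exp_pos _).le
    · rfl

theorem IsIIDWithMass.measurable_prod_tiltWeight (h : IsIIDWithMass P X p) (μ B θ : ℝ)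
    (R : Finset ℕ) : Measurable fun ω => ∏ i ∈ R, tiltWeight μ B θ (X i ω) :=
  Finset.measurable_prod _ fun i _ =>
    (measurable_of_countable (tiltWeight μ B θ)).comp (h.measurable i)

theorem IsIIDWithMass.lintegral_prod_tiltWeight (h : IsIIDWithMass P X p) (μ B θ : ℝ)
    (R : Finset ℕ) :
    ∫⁻ ω, ∏ i ∈ R, tiltWeight μ B θ (X i ω) ∂P = ENNReal.ofReal (truncMGF p μ B θ ^ R.card) := by
  have hprod := lintegral_prod_eq_prod_lintegral_of_indepFun R
    (fun i ω => tiltWeight μ B θ (X i ω))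
    (h.indep.comp (fun _ => tiltWeight μ B θ) fun _ => measurable_of_countable _)
    fun i => (measurable_of_countable (tiltWeight μ B θ)).comp (h.measurable i)
  rw [hprod, ENNReal.ofReal_pow (truncMGF_nonneg h.nonneg μ B θ), ← Finset.prod_const]
  exact Finset.prod_congr rfl fun i _ => h.lintegral_tiltWeight μ B θ i

theorem IsIIDWithMass.measure_le_exp_neg_mul_truncMGF_pow (h : IsIIDWithMass P X p)
    (μ B θ w : ℝ) (R : Finset ℕ) :
    P {ω | (∀ i ∈ R, (X i ω : ℝ) ≤ B) ∧ w ≤ θ * ∑ i ∈ R, ((X i ω : ℝ) - μ)} ≤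
      ENNReal.ofReal (Real.exp (-w) * truncMGF p μ B θ ^ R.card) := by
  have hw : 0 < Real.exp w := Real.exp_pos w
  have hchebyshev := meas_ge_le_lintegral_div
    (h.measurable_prod_tiltWeight μ B θ R).aemeasurable (μ := P)
    (ENNReal.ofReal_pos.mpr hw).ne' ENNReal.ofReal_ne_top
  rw [h.lintegral_prod_tiltWeight, ← ENNReal.ofReal_div_of_pos hw, div_eq_inv_mul,
    ← Real.exp_neg] at hchebyshev
  refine (measure_mono ?_).trans hchebyshev
  rintro ω ⟨hB, hω⟩
  rw [Set.mem_ofPred_eq, prod_tiltWeight (fun i => X i ω), if_pos hB]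
  exact ENNReal.ofReal_le_ofReal (Real.exp_le_exp.mpr hω)

theorem IsIIDWithMass.ofReal_truncMGF_pow_le (h : IsIIDWithMass P X p) (μ B : ℝ) {θ τ w a b : ℝ}
    (hτ : 0 ≤ τ) (hw : ∀ z ∈ Set.Icc a b, θ * z ≤ w) (R : Finset ℕ) :
    ENNReal.ofReal (truncMGF p μ B θ ^ R.card) ≤
      ENNReal.ofReal (Real.exp w) * P {ω | (fun i => X i ω) ∈ truncWindow R μ B a b} +
      ENNReal.ofReal (Real.exp (-(τ * b))) * ENNReal.ofReal (truncMGF p μ B (θ + τ) ^ R.card) +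
      ENNReal.ofReal (Real.exp (τ * a)) * ENNReal.ofReal (truncMGF p μ B (θ - τ) ^ R.card) := by
  have hwindow : MeasurableSet {ω | (fun i => X i ω) ∈ truncWindow R μ B a b} :=
    measurableSet_of_dependsOn h.measurable (dependsOn_mem_truncWindow R μ B a b)
  have hmeas := fun θ => h.measurable_prod_tiltWeight μ B θ R
  have hmono := lintegral_mono (μ := P) fun ω => prod_tiltWeight_le (fun i => X i ω) μ B hτ hw R
  rw [lintegral_add_right _ ((hmeas _).const_mul _), lintegral_add_right _ ((hmeas _).const_mul _),
    lintegral_const_mul _ (hmeas _), lintegral_const_mul _ (hmeas _)] at hmono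
  have hindicator : ∫⁻ ω, ENNReal.ofReal (Real.exp w) *
      (truncWindow R μ B a b).indicator 1 (fun i => X i ω) ∂P =
      ENNReal.ofReal (Real.exp w) * P {ω | (fun i => X i ω) ∈ truncWindow R μ B a b} := by
    rw [← lintegral_indicator_one hwindow]
    exact lintegral_const_mul _ (measurable_one.indicator hwindow)
  simpa only [h.lintegral_prod_tiltWeight, hindicator] using hmono

theorem IsIIDWithMass.truncMGF_pow_le [IsFiniteMeasure P] (h : IsIIDWithMass P X p) (μ B : ℝ)
    {θ τ w a b : ℝ} (hτ : 0 ≤ τ) (hw : ∀ z ∈ Set.Icc a b, θ * z ≤ w) (R : Finset ℕ) :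
    truncMGF p μ B θ ^ R.card ≤
      Real.exp w * P.real {ω | (fun i => X i ω) ∈ truncWindow R μ B a b} +
      Real.exp (-(τ * b)) * truncMGF p μ B (θ + τ) ^ R.card +
      Real.exp (τ * a) * truncMGF p μ B (θ - τ) ^ R.card := by
  have hφ := fun θ => pow_nonneg (truncMGF_nonneg h.nonneg μ B θ) R.card
  have hle := h.ofReal_truncMGF_pow_le μ B hτ hw R
  rw [← ofReal_measureReal] at hle
  have hup := hφ (θ + τ)
  have hdown := hφ (θ - τ)
  rw [← ENNReal.ofReal_mul (Real.exp_pos _).le, ← ENNReal.ofReal_mul (Real.exp_pos _).le,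
    ← ENNReal.ofReal_mul (Real.exp_pos _).le, ← ENNReal.ofReal_add (by positivity) (by positivity),
    ← ENNReal.ofReal_add (by positivity) (by positivity)] at hle
  exact (ENNReal.ofReal_le_ofReal_iff (by positivity)).mp hle

end IID

section Tail

variable {Ω : Type*} [MeasurableSpace Ω] {P : Measure Ω} {X : ℕ → Ω → ℕ} {c α κ : ℝ}

/-- The price, beyond the factor `exp (-(1 - κ) * a ^ α)`, of the Chernoff tail bound at `a` for the
law proportional to `exp (-k ^ α)`. -/
noncomputable def tailConst (c α κ : ℝ) : ℝ :=
  ∑' k : ℕ, c * Real.exp (-κ * (k : ℝ) ^ α)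

theorem summable_tailConst (c : ℝ) (hα : 0 < α) (hκ0 : 0 < κ) :
    Summable fun k : ℕ => c * Real.exp (-κ * (k : ℝ) ^ α) := by
  simpa using (summable_add_pow_mul_exp_neg_rpow hα hκ0 0 0).mul_left c

theorem tailConst_pos (hc : 0 < c) (hα : 0 < α) (hκ0 : 0 < κ) : 0 < tailConst c α κ :=
  (summable_tailConst c hα hκ0).tsum_pos (fun k => by positivity) 0 (by positivity)

theorem IsIIDWithMass.measure_ge_le (h : IsIIDWithMass P X (stretchedExp c α)) (hc : 0 ≤ c)
    (hα : 0 < α) (hκ0 : 0 < κ) (hκ1 : κ ≤ 1) (a : ℝ) (i : ℕ) :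
    P {ω | a ≤ X i ω} ≤ ENNReal.ofReal (tailConst c α κ *
        Real.exp (-(1 - κ) * (max a 0) ^ α)) := by
  have hmeas : MeasurableSet {ω | a ≤ X i ω} :=
    h.measurable i (Set.to_countable {k : ℕ | a ≤ k}).measurableSet
  rw [← lintegral_indicator_one hmeas]
  refine (h.lintegral_comp ({k : ℕ | a ≤ k}.indicator 1) i).trans_le ?_
  rw [tailConst, ← tsum_mul_right, ENNReal.ofReal_tsum_of_nonneg (fun k => by positivity)
    ((summable_tailConst c hα hκ0).mul_right _)]
  refine ENNReal.tsum_le_tsum fun k => ?_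
  by_cases hk : a ≤ (k : ℝ)
  · rw [Set.indicator_of_mem (by exact hk), Pi.one_apply, one_mul, stretchedExp, mul_assoc,
      ← Real.exp_add]
    have hrpow : (max a 0) ^ α ≤ (k : ℝ) ^ α :=
      Real.rpow_le_rpow (le_max_right _ _) (max_le hk k.cast_nonneg) hα.le
    gcongr
    nlinarith
  · rw [Set.indicator_of_notMem (by exact hk), zero_mul]
    exact zero_le

theorem IsIIDWithMass.measure_large_and_trunc_le (h : IsIIDWithMass P X (stretchedExp c α))
    (hc : 0 ≤ c) (hα : 0 < α) (hκ0 : 0 < κ) (hκ1 : κ ≤ 1) (μ B θ w : ℝ) (a : ℕ → ℝ)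
    {J R : Finset ℕ} (hJR : Disjoint J R) :
    P {ω | (∀ i ∈ J, a i ≤ X i ω) ∧ (∀ i ∈ R, (X i ω : ℝ) ≤ B) ∧
        w ≤ θ * ∑ i ∈ R, ((X i ω : ℝ) - μ)} ≤
      ENNReal.ofReal ((∏ i ∈ J, tailConst c α κ *
        Real.exp (-(1 - κ) * (max (a i) 0) ^ α)) *
        (Real.exp (-w) * truncMGF (stretchedExp c α) μ B θ ^ R.card)) := by
  have htail (i : ℕ) : 0 ≤ tailConst c α κ *
      Real.exp (-(1 - κ) * (max (a i) 0) ^ α) :=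
    mul_nonneg (tsum_nonneg fun k => by positivity) (Real.exp_pos _).le
  refine (measure_and_eq_mul_of_dependsOn h.measurable h.indep hJR
    (dependsOn_forall_mem J fun i => {k : ℕ | a i ≤ k})
    (dependsOn_forall_le_and_sum R μ B fun z => w ≤ θ * z)).trans_le ?_
  rw [measure_forall_mem_eq_prod h.indep J fun i => {k : ℕ | a i ≤ k},
    ENNReal.ofReal_mul (Finset.prod_nonneg fun i _ => htail i),
    ENNReal.ofReal_prod_of_nonneg fun i _ => htail i]
  exact mul_le_mul' (Finset.prod_le_prod' fun i _ => h.measure_ge_le hc hα hκ0 hκ1 (a i) i)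
    (h.measure_le_exp_neg_mul_truncMGF_pow μ B θ w R)

end Tail

/-! ### Order statistics -/

section OrderStatistics

theorem exists_perm_revOrderStat {n : ℕ} (x : Fin n → ℕ) :
    ∃ ρ : Equiv.Perm (Fin n), ∀ j, x (ρ j) = revOrderStat x j :=
  ⟨Fin.revPerm.trans (Tuple.sort x), fun j => by simp [revOrderStat]⟩

theorem exists_positions_of_largest {n K : ℕ} (hK : 1 ≤ K) (hKn : K ≤ n) (x : Fin n → ℕ) :
    ∃ e : Fin K → Fin n, Function.Injective e ∧ (∀ j, x (e j) = revOrderStat x j) ∧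
      ∀ i, (∀ j, e j ≠ i) → x i ≤ revOrderStat x (K - 1) := by
  obtain ⟨ρ, hρ⟩ := exists_perm_revOrderStat x
  refine ⟨fun j => ρ (Fin.castLE hKn j), fun a b h => ?_, fun j => by simp [hρ], fun i hi => ?_⟩
  · exact Fin.castLE_injective hKn (ρ.injective h)
  · have hge : K ≤ (ρ.symm i : ℕ) := by
      by_contra! hlt
      exact hi ⟨ρ.symm i, hlt⟩ (by simp)
    rw [← ρ.apply_symm_apply i, hρ]
    exact revOrderStat_antitone x (by omega)

theorem exists_le_and_le_perm {n : ℕ} (ρ : Equiv.Perm (Fin n)) (j : Fin n) :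
    ∃ i ≤ j, j ≤ ρ i := by
  by_contra! h
  have hcard := Finset.card_le_card_of_injOn (s := Finset.Iic j) (t := Finset.Iio j) ρ
    (fun i hi => by simpa using h i (by simpa using hi)) ρ.injective.injOn
  simp at hcard

theorem abs_revOrderStat_sub_le {n : ℕ} (x : Fin n → ℕ) {y : ℕ → ℝ} (hy : Antitone y) {η : ℝ}
    (h : ∀ i : Fin n, |(x i : ℝ) - y i| ≤ η) (j : Fin n) : |(revOrderStat x j : ℝ) - y j| ≤ η := by
  obtain ⟨ρ, hρ⟩ := exists_perm_revOrderStat x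
  rw [abs_sub_le_iff]
  constructor
  · obtain ⟨i, hij, hji⟩ := exists_le_and_le_perm ρ j
    have hx : (revOrderStat x j : ℝ) ≤ x (ρ i) := by
      rw [hρ]
      exact_mod_cast revOrderStat_antitone x hij
    have hyi : y (ρ i) ≤ y j := hy hji
    linarith [(abs_sub_le_iff.mp (h (ρ i))).1]
  · obtain ⟨i, hij, hji⟩ := exists_le_and_le_perm ρ.symm j
    have hx : (x i : ℝ) ≤ revOrderStat x j := by
      rw [← ρ.apply_symm_apply i, hρ]
      exact_mod_cast revOrderStat_antitone x hji
    have hyi : y j ≤ y i := hy hij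
    linarith [(abs_sub_le_iff.mp (h i)).2]

theorem coe_scaledOrderStats (γ : ℝ) {n : ℕ} (x : Fin n → ℕ) (j : ℕ) :
    (((scaledOrderStats γ x).1 j : ℝ≥0) : ℝ) = revOrderStat x j / (n : ℝ) ^ γ := by
  simp [scaledOrderStats]

end OrderStatistics

/-! ### The energy functional -/

/-- A finite-dimensional minorant of the energy: the quadratic is replaced by its tangent with
slope `t` and the sums are restricted to the first `K` terms. -/
noncomputable def minorant (α v s t : ℝ) (K : ℕ) (x : DecSeq) : ℝ :=
  ∑ j ∈ Finset.range K, (x.1 j : ℝ) ^ α + t * (s - ∑ j ∈ Finset.range K, (x.1 j : ℝ)) -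
    t ^ 2 * v / 2

/-- The sequence obtained by replacing the entries of index at least `K` by `0`. -/
def DecSeq.truncate (x : DecSeq) (K : ℕ) : DecSeq :=
  ⟨fun j => if j < K then x.1 j else 0, fun i j hij => by
    dsimp only
    split_ifs
    · exact x.2 hij
    · omega
    · exact zero_le
    · exact le_rfl⟩

theorem DecSeq.truncate_of_lt (x : DecSeq) {K j : ℕ} (hj : j < K) : (x.truncate K).1 j = x.1 j :=
  if_pos hj

theorem DecSeq.truncate_of_le (x : DecSeq) {K j : ℕ} (hj : K ≤ j) : (x.truncate K).1 j = 0 :=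
  if_neg hj.not_gt

section Energy

variable {α v s t : ℝ}

theorem energy_eq_ofReal (hα0 : 0 < α) (hv : 0 < v) {x : DecSeq}
    (hpow : Summable fun j => (x.1 j : ℝ) ^ α) (hsum : Summable fun j => (x.1 j : ℝ)) :
    energy α v s x =
      ENNReal.ofReal (∑' j, (x.1 j : ℝ) ^ α + (s - ∑' j, (x.1 j : ℝ)) ^ 2 / (2 * v)) := by
  have hpow' : (∑' j, (x.1 j : ℝ≥0∞) ^ α) = ENNReal.ofReal (∑' j, (x.1 j : ℝ) ^ α) := by
    rw [ENNReal.ofReal_tsum_of_nonneg (fun j => by positivity) hpow]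
    refine tsum_congr fun j => ?_
    rw [← ENNReal.ofReal_rpow_of_nonneg (x.1 j).coe_nonneg hα0.le, ENNReal.ofReal_coe_nnreal]
  have hsum' : (∑' j, (x.1 j : ℝ≥0∞)) = ENNReal.ofReal (∑' j, (x.1 j : ℝ)) := by
    rw [ENNReal.ofReal_tsum_of_nonneg (fun j => by positivity) hsum]
    simp
  rw [energy, hpow', hsum', if_neg ENNReal.ofReal_ne_top,
    ENNReal.toReal_ofReal (tsum_nonneg fun j => by positivity),
    ← ENNReal.ofReal_add (tsum_nonneg fun j => by positivity) (by positivity)]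

theorem summable_of_energy_ne_top (hα0 : 0 < α) {x : DecSeq} (h : energy α v s x ≠ ⊤) :
    (Summable fun j => (x.1 j : ℝ) ^ α) ∧ Summable fun j => (x.1 j : ℝ) := by
  rw [energy] at h
  have hpow : (∑' j, ((x.1 j ^ α : ℝ≥0) : ℝ≥0∞)) ≠ ⊤ := by
    simpa only [ENNReal.coe_rpow_of_nonneg _ hα0.le] using (ENNReal.add_ne_top.mp h).1
  have hsum : (∑' j, (x.1 j : ℝ≥0∞)) ≠ ⊤ := fun htop => by simp [htop] at h
  refine ⟨?_, NNReal.summable_coe.mpr (ENNReal.tsum_coe_ne_top_iff_summable.mp hsum)⟩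
  exact_mod_cast NNReal.summable_coe.mpr (ENNReal.tsum_coe_ne_top_iff_summable.mp hpow)

theorem ofReal_minorant_le_energy (hα0 : 0 < α) (hα1 : α < 1) (hv : 0 < v) {K : ℕ}
    {x : DecSeq} (ht : t * (x.1 (K - 1) : ℝ) ^ (1 - α) ≤ 1) :
    ENNReal.ofReal (minorant α v s t K x) ≤ energy α v s x := by
  rcases eq_or_ne (energy α v s x) ⊤ with htop | htop
  · rw [htop]
    exact le_top
  obtain ⟨hpow, hsum⟩ := summable_of_energy_ne_top hα0 htop
  have htail : t * ∑' j, (x.1 (j + K) : ℝ) ≤ ∑' j, (x.1 (j + K) : ℝ) ^ α := by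
    rw [← tsum_mul_left]
    refine Summable.tsum_le_tsum (fun j => ?_) (((summable_nat_add_iff K).mpr hsum).mul_left t)
      ((summable_nat_add_iff K).mpr hpow)
    have hle : (x.1 (j + K) : ℝ) ≤ x.1 (K - 1) := by exact_mod_cast x.2 (by omega)
    simpa using mul_le_mul_rpow_of_le hα1 zero_le_one (x.1 (j + K)).coe_nonneg hle ht
  have htangent : t * (s - ∑' j, (x.1 j : ℝ)) - t ^ 2 * v / 2 ≤
      (s - ∑' j, (x.1 j : ℝ)) ^ 2 / (2 * v) := by
    rw [le_div_iff₀ (by positivity)]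
    nlinarith [sq_nonneg (s - ∑' j, (x.1 j : ℝ) - t * v)]
  rw [energy_eq_ofReal hα0 hv hpow hsum]
  apply ENNReal.ofReal_le_ofReal
  rw [minorant, ← hpow.sum_add_tsum_nat_add K]
  rw [← hsum.sum_add_tsum_nat_add K] at htangent ⊢
  linarith

theorem summable_of_summable_rpow (hα0 : 0 < α) (hα1 : α ≤ 1) {x : ℕ → ℝ} (hx : ∀ j, 0 ≤ x j)
    (h : Summable fun j => x j ^ α) : Summable x := by
  refine h.of_norm_bounded_eventually_nat ?_
  filter_upwards [h.tendsto_atTop_zero.eventually_le_const one_pos] with j hj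
  have hx1 : x j ≤ 1 := by
    by_contra! hlt
    exact absurd hj (not_le.mpr (Real.one_lt_rpow hlt hα0))
  rw [Real.norm_of_nonneg (hx j)]
  simpa using Real.rpow_le_rpow_of_exponent_ge' (hx j) hx1 hα0.le hα1

-- The optimal slope is `t = (s - ∑ x_j) / v`, where the tangent touches the quadratic.
theorem tendsto_minorant {x : DecSeq} (hv : v ≠ 0)
    (hpow : Summable fun j => (x.1 j : ℝ) ^ α) (hsum : Summable fun j => (x.1 j : ℝ)) :
    Tendsto (fun K => minorant α v s ((s - ∑' j, (x.1 j : ℝ)) / v) K x) atTop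
      (𝓝 (∑' j, (x.1 j : ℝ) ^ α + (s - ∑' j, (x.1 j : ℝ)) ^ 2 / (2 * v))) := by
  set t := (s - ∑' j, (x.1 j : ℝ)) / v with ht
  have hvalue : ∑' j, (x.1 j : ℝ) ^ α + (s - ∑' j, (x.1 j : ℝ)) ^ 2 / (2 * v) =
      ∑' j, (x.1 j : ℝ) ^ α + t * (s - ∑' j, (x.1 j : ℝ)) - t ^ 2 * v / 2 := by
    rw [ht]
    field_simp
    ring
  rw [hvalue]
  exact (hpow.hasSum.tendsto_sum_nat.add
    ((hsum.hasSum.tendsto_sum_nat.const_sub s).const_mul t)).sub_const _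

theorem exists_lt_minorant (hα0 : 0 < α) (hα1 : α < 1) (hv : 0 < v) {x : DecSeq} {L : ℝ≥0}
    (hL : L < energy α v s x) :
    ∃ t : ℝ, ∃ K : ℕ, 1 ≤ K ∧ t * (x.1 (K - 1) : ℝ) ^ (1 - α) < 1 / 2 ∧
      L < minorant α v s t K x := by
  by_cases hpow : Summable fun j => (x.1 j : ℝ) ^ α
  · have hsum := summable_of_summable_rpow hα0 hα1.le (fun j => (x.1 j).coe_nonneg) hpow
    rw [energy_eq_ofReal hα0 hv hpow hsum, ← ENNReal.ofReal_coe_nnreal,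
      ENNReal.ofReal_lt_ofReal_iff_of_nonneg L.coe_nonneg] at hL
    set t := (s - ∑' j, (x.1 j : ℝ)) / v
    have hslope : Tendsto (fun K => t * (x.1 (K - 1) : ℝ) ^ (1 - α)) atTop (𝓝 0) := by
      have hlim := (hsum.tendsto_atTop_zero.comp (tendsto_sub_atTop_nat 1)).rpow_const
        (p := 1 - α) (Or.inr (by linarith))
      rw [Real.zero_rpow (by linarith)] at hlim
      simpa using hlim.const_mul t
    obtain ⟨K, hK⟩ := ((eventually_ge_atTop 1).and
      ((hslope.eventually_lt_const (by norm_num : (0 : ℝ) < 1 / 2)).and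
        ((tendsto_minorant hv.ne' hpow hsum).eventually_const_lt hL))).exists
    exact ⟨t, K, hK⟩
  · have hdiv := (not_summable_iff_tendsto_nat_atTop_of_nonneg fun j => by positivity).mp hpow
    obtain ⟨K, hK1, hK⟩ := ((eventually_ge_atTop 1).and (hdiv.eventually_gt_atTop (L : ℝ))).exists
    exact ⟨0, K, hK1, by norm_num, by simpa [minorant] using hK⟩

theorem continuous_coe_apply (j : ℕ) : Continuous fun x : DecSeq => (x.1 j : ℝ) :=
  NNReal.continuous_coe.comp ((continuous_apply j).comp continuous_subtype_val)

theorem continuous_minorant (hα0 : 0 ≤ α) (t : ℝ) (K : ℕ) : Continuous (minorant α v s t K) :=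
  ((continuous_finsetSum _ fun j _ => (continuous_coe_apply j).rpow_const
    fun _ => Or.inr hα0).add ((continuous_const.sub
    (continuous_finsetSum _ fun j _ => continuous_coe_apply j)).const_mul t)).sub continuous_const

theorem eventually_mul_rpow_lt (hα1 : α ≤ 1) {x : DecSeq} {j : ℕ} {b : ℝ}
    (h : t * (x.1 j : ℝ) ^ (1 - α) < b) : ∀ᶠ y : DecSeq in 𝓝 x, t * (y.1 j : ℝ) ^ (1 - α) < b :=
  (((continuous_coe_apply j).rpow_const fun _ => Or.inr (by linarith)).const_mul
    t).continuousAt.eventually_lt_const h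

theorem lowerSemicontinuous_energy (hα0 : 0 < α) (hα1 : α < 1) (hv : 0 < v) :
    LowerSemicontinuous (energy α v s) := by
  intro x b hb
  lift b to ℝ≥0 using hb.ne_top
  obtain ⟨t, K, -, hK, hlt⟩ := exists_lt_minorant hα0 hα1 hv hb
  filter_upwards [eventually_mul_rpow_lt hα1.le hK,
    (continuous_minorant hα0.le t K).continuousAt.eventually_const_lt hlt] with y hyK hy
  refine lt_of_lt_of_le ?_ (ofReal_minorant_le_energy hα0 hα1 hv (hyK.le.trans (by norm_num)))
  rw [← ENNReal.ofReal_coe_nnreal]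
  exact (ENNReal.ofReal_lt_ofReal_iff_of_nonneg b.coe_nonneg).mpr hy

theorem isCompact_apply_zero_le (M : ℝ≥0) : IsCompact {x : DecSeq | x.1 0 ≤ M} := by
  have hclosed : IsClosed {x : ℕ → ℝ≥0 | Antitone x} := by
    have hinter : {x : ℕ → ℝ≥0 | Antitone x} = ⋂ i, ⋂ j, ⋂ _ : i ≤ j, {x | x j ≤ x i} := by
      ext
      simp [Antitone]
    rw [hinter]
    exact isClosed_iInter fun i => isClosed_iInter fun j => isClosed_iInter fun _ =>
      isClosed_le (continuous_apply j) (continuous_apply i)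
  have hbox : IsCompact (Set.univ.pi fun _ : ℕ => Set.Icc (0 : ℝ≥0) M) :=
    isCompact_univ_pi fun _ => isCompact_Icc
  refine (hclosed.isClosedEmbedding_subtypeVal.isCompact_preimage hbox).of_isClosed_subset ?_ ?_
  · exact isClosed_le ((continuous_apply 0).comp continuous_subtype_val) continuous_const
  · exact fun x hx j _ => ⟨zero_le, (x.2 (Nat.zero_le j)).trans hx⟩

theorem isCompact_energy_le (hα0 : 0 < α) (hα1 : α < 1) (hv : 0 < v) (b : ℝ≥0) :
    IsCompact {x : DecSeq | energy α v s x ≤ b} := by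
  refine (isCompact_apply_zero_le (b ^ α⁻¹)).of_isClosed_subset
    ((lowerSemicontinuous_energy hα0 hα1 hv).isClosed_preimage _) fun x hx => ?_
  have hfirst : (x.1 0 : ℝ≥0∞) ^ α ≤ b := ((ENNReal.le_tsum 0).trans le_self_add).trans hx
  rw [← ENNReal.coe_rpow_of_nonneg _ hα0.le, ENNReal.coe_le_coe] at hfirst
  exact (NNReal.le_rpow_inv_iff hα0).mpr hfirst

theorem iInf_energy_ne_top (hα0 : 0 < α) (hv : 0 < v) : ⨅ y, energy α v s y ≠ ⊤ := by
  refine ne_top_of_le_ne_top ?_ (iInf_le _ (⟨fun _ => 0, fun _ _ _ => le_rfl⟩ : DecSeq))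
  rw [energy_eq_ofReal hα0 hv]
  · exact ENNReal.ofReal_ne_top
  · simp [Real.zero_rpow hα0.ne', summable_zero]
  · simp [summable_zero]

theorem tendsto_truncate (x : DecSeq) : Tendsto x.truncate atTop (𝓝 x) := by
  rw [tendsto_subtype_rng, tendsto_pi_nhds]
  refine fun j => tendsto_const_nhds.congr' ?_
  filter_upwards [eventually_gt_atTop j] with K hK
  exact (if_pos hK).symm

theorem exists_truncate_mem_and_lt (hα0 : 0 < α) (hv : 0 < v) {x : DecSeq} {L : ℝ≥0}
    (hL : energy α v s x < L) {O : Set DecSeq} (hO : IsOpen O) (hx : x ∈ O) :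
    ∃ K : ℕ, x.truncate K ∈ O ∧ ∑ j ∈ Finset.range K, (x.1 j : ℝ) ^ α +
        (s - ∑ j ∈ Finset.range K, (x.1 j : ℝ)) ^ 2 / (2 * v) < L := by
  obtain ⟨hpow, hsum⟩ := summable_of_energy_ne_top hα0 hL.ne_top
  rw [energy_eq_ofReal hα0 hv hpow hsum, ← ENNReal.ofReal_coe_nnreal,
    ENNReal.ofReal_lt_ofReal_iff_of_nonneg
      (add_nonneg (tsum_nonneg fun j => by positivity) (by positivity))] at hL
  have hlim := hpow.hasSum.tendsto_sum_nat.add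
    (((hsum.hasSum.tendsto_sum_nat.const_sub s).pow 2).div_const (2 * v))
  exact (((tendsto_truncate x).eventually (hO.mem_nhds hx)).and
    (hlim.eventually_lt_const hL)).exists

theorem exists_forall_abs_sub_le_imp_mem {O : Set DecSeq} (hO : IsOpen O) {x : DecSeq}
    (hx : x ∈ O) :
    ∃ η : ℝ, 0 < η ∧ ∀ y : DecSeq, (∀ j, |(y.1 j : ℝ) - x.1 j| ≤ η) → y ∈ O := by
  by_contra! hcon
  choose! y hy hyO using fun m : ℕ => hcon (1 / ((m : ℝ) + 1)) (by positivity)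
  have hlim : Tendsto y atTop (𝓝 x) := by
    rw [tendsto_subtype_rng, tendsto_pi_nhds]
    intro j
    rw [← NNReal.tendsto_coe, tendsto_iff_norm_sub_tendsto_zero]
    exact squeeze_zero (fun _ => norm_nonneg _) (fun m => hy m j)
      tendsto_one_div_add_atTop_nhds_zero_nat
  obtain ⟨m, hm⟩ := (hlim.eventually (hO.mem_nhds hx)).exists
  exact hyO m hm

end Energy

/-! ### The upper bound -/

/-- The configuration `x` has values at least `b j` at the distinct positions `e j`, values at most
`B` elsewhere, and `w` is a lower bound for the tilted centred sum over the other positions. -/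
structure HasJumpsAt (μ B θ w : ℝ) {n K : ℕ} (b : Fin K → ℝ) (e : Fin K → Fin n)
    (x : Fin n → ℕ) : Prop where
  injective : Function.Injective e
  le_apply : ∀ j, b j ≤ x (e j)
  apply_le : ∀ i, (∀ j, e j ≠ i) → (x i : ℝ) ≤ B
  le_mul_sum : w ≤ θ * (∑ i, ((x i : ℝ) - μ) - ∑ j, ((x (e j) : ℝ) - μ))

section UpperBound

variable {Ω : Type*} [MeasurableSpace Ω] {P : Measure Ω} {α c μ v γ s κ : ℝ} {X : ℕ → Ω → ℕ}

theorem IsIIDWithMass.measure_hasJumpsAt_le (h : IsIIDWithMass P X (stretchedExp c α)) (hc : 0 ≤ c)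
    (hα : 0 < α) (hκ0 : 0 < κ) (hκ1 : κ ≤ 1) (μ B θ w : ℝ) {n K : ℕ} (b : Fin K → ℝ)
    (e : Fin K → Fin n) :
    P {ω | HasJumpsAt μ B θ w b e fun i => X i ω} ≤
      ENNReal.ofReal ((∏ j, tailConst c α κ * Real.exp (-(1 - κ) * (max (b j) 0) ^ α)) *
        (Real.exp (-w) * truncMGF (stretchedExp c α) μ B θ ^ (n - K))) := by
  by_cases he : Function.Injective e
  swap
  · simp [fun ω => show ¬ HasJumpsAt μ B θ w b e fun i => X i ω from fun hω => he hω.injective]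
  set f : Fin K → ℕ := fun j => e j
  have hf : Function.Injective f := Fin.val_injective.comp he
  set J : Finset ℕ := Finset.univ.image f with hJ
  have hJn : J ⊆ Finset.range n := Finset.image_subset_iff.mpr fun j _ => by simp [f]
  have hcard : (Finset.range n \ J).card = n - K := by
    rw [Finset.card_sdiff_of_subset hJn, hJ, Finset.card_image_of_injective _ hf]
    simp
  have hbound := h.measure_large_and_trunc_le hc hα hκ0 hκ1 μ B θ w (Function.extend f b 0)
    (J := J) (R := Finset.range n \ J) Finset.disjoint_sdiff
  rw [hcard, hJ, Finset.prod_image hf.injOn] at hbound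
  simp only [hf.extend_apply] at hbound
  refine le_trans (measure_mono ?_) hbound
  refine fun ω (hω : HasJumpsAt μ B θ w b e _) => ⟨fun i hi => ?_, fun i hi => ?_, ?_⟩
  · obtain ⟨j, -, rfl⟩ := Finset.mem_image.mp hi
    rw [hf.extend_apply]
    exact hω.le_apply j
  · obtain ⟨hin, hiJ⟩ := Finset.mem_sdiff.mp hi
    refine hω.apply_le ⟨i, Finset.mem_range.mp hin⟩ fun j hj => hiJ ?_
    exact Finset.mem_image.mpr ⟨j, Finset.mem_univ _, by simp [f, hj]⟩
  · rw [Finset.sum_sdiff_eq_sub hJn, Finset.sum_image hf.injOn, Finset.sum_range]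
    exact hω.le_mul_sum

theorem IsIIDWithMass.measure_exists_hasJumpsAt_le (h : IsIIDWithMass P X (stretchedExp c α))
    (hc : 0 ≤ c) (hα : 0 < α) (hκ0 : 0 < κ) (hκ1 : κ ≤ 1) (μ B θ w : ℝ) (n : ℕ) {K : ℕ}
    (b : Fin K → ℝ) :
    P {ω | ∃ e : Fin K → Fin n, HasJumpsAt μ B θ w b e fun i => X i ω} ≤
      ENNReal.ofReal ((n : ℝ) ^ K *
        ((∏ j, tailConst c α κ * Real.exp (-(1 - κ) * (max (b j) 0) ^ α)) *
        (Real.exp (-w) * truncMGF (stretchedExp c α) μ B θ ^ (n - K)))) := by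
  rw [Set.ofPred_exists]
  refine (measure_iUnion_fintype_le P _).trans ?_
  refine (Finset.sum_le_sum fun e _ =>
    h.measure_hasJumpsAt_le hc hα hκ0 hκ1 μ B θ w b e).trans_eq ?_
  rw [Finset.sum_const, Finset.card_univ, Fintype.card_fun, Fintype.card_fin, Fintype.card_fin,
    nsmul_eq_mul, ENNReal.ofReal_mul (p := (n : ℝ) ^ K) (by positivity),
    ENNReal.ofReal_pow (by positivity)]
  simp

theorem abs_revOrderStat_sub_mul_le {n : ℕ} (hn : 0 < n) {x : Fin n → ℕ} {y : DecSeq} {ε : ℝ}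
    {j : ℕ} (hj : |((scaledOrderStats γ x).1 j : ℝ) - y.1 j| ≤ ε) :
    |(revOrderStat x j : ℝ) - y.1 j * (n : ℝ) ^ γ| ≤ ε * (n : ℝ) ^ γ := by
  have hr : (0 : ℝ) < (n : ℝ) ^ γ := by positivity
  rw [coe_scaledOrderStats] at hj
  calc |(revOrderStat x j : ℝ) - y.1 j * (n : ℝ) ^ γ|
      = |(revOrderStat x j : ℝ) / (n : ℝ) ^ γ - y.1 j| * (n : ℝ) ^ γ := by
        rw [← abs_of_pos hr, ← abs_mul, abs_of_pos hr, sub_mul, div_mul_cancel₀ _ hr.ne']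
    _ ≤ ε * (n : ℝ) ^ γ := by gcongr

theorem exists_hasJumpsAt_of_abs_sub_le {n K : ℕ} (hK : 1 ≤ K) (hKn : K ≤ n) (μ θ : ℝ)
    {x : Fin n → ℕ} {y : DecSeq} {ε : ℝ}
    (hxy : ∀ j < K, |((scaledOrderStats γ x).1 j : ℝ) - y.1 j| ≤ ε) :
    ∃ e : Fin K → Fin n, HasJumpsAt μ (((y.1 (K - 1) : ℝ) + ε) * (n : ℝ) ^ γ) θ
      (θ * (∑ i, ((x i : ℝ) - μ) + K * μ - (∑ j : Fin K, (y.1 j : ℝ)) * (n : ℝ) ^ γ) -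
        |θ| * (K * (ε * (n : ℝ) ^ γ)))
      (fun j => ((y.1 j : ℝ) - ε) * (n : ℝ) ^ γ) e x := by
  obtain ⟨e, he, hex, hrest⟩ := exists_positions_of_largest hK hKn x
  have hstat (j : ℕ) (hj : j < K) := abs_revOrderStat_sub_mul_le (hK.trans hKn) (hxy j hj)
  have hlarge (j : Fin K) : |(x (e j) : ℝ) - y.1 j * (n : ℝ) ^ γ| ≤ ε * (n : ℝ) ^ γ := by
    rw [hex]
    exact hstat j j.2
  refine ⟨e, he, fun j => ?_, fun i hi => ?_, ?_⟩
  · linarith [(abs_le.mp (hlarge j)).1]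
  · have hi' : (x i : ℝ) ≤ revOrderStat x (K - 1) := by exact_mod_cast hrest i hi
    linarith [(abs_le.mp (hstat (K - 1) (by omega))).2]
  · have hsum : |∑ j, (x (e j) : ℝ) - (∑ j : Fin K, (y.1 j : ℝ)) * (n : ℝ) ^ γ| ≤
        K * (ε * (n : ℝ) ^ γ) := by
      rw [Finset.sum_mul, ← Finset.sum_sub_distrib]
      refine (Finset.abs_sum_le_sum_abs _ _).trans ?_
      simpa using Finset.sum_le_sum fun j (_ : j ∈ Finset.univ) => hlarge j
    have htilt : θ * (∑ j, (x (e j) : ℝ) - (∑ j : Fin K, (y.1 j : ℝ)) * (n : ℝ) ^ γ) ≤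
        |θ| * (K * (ε * (n : ℝ) ^ γ)) :=
      (le_abs_self _).trans (by rw [abs_mul]; gcongr)
    simp only [Finset.sum_sub_distrib (s := (Finset.univ : Finset (Fin K))), Finset.sum_const,
      Finset.card_univ, Fintype.card_fin, nsmul_eq_mul]
    linarith

theorem pow_eq_exp_mul_log {a : ℝ} (ha : 0 < a) (m : ℕ) : a ^ m = Real.exp (m * Real.log a) := by
  rw [Real.exp_nat_mul, Real.exp_log ha]

theorem prod_tailConst_mul_exp (hc : 0 < c) (hα : 0 < α) (hκ0 : 0 < κ) {K : ℕ} (b : Fin K → ℝ)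
    (n : ℕ) :
    ∏ j, tailConst c α κ * Real.exp (-(1 - κ) * (max (b j * (n : ℝ) ^ γ) 0) ^ α) =
      Real.exp (K * Real.log (tailConst c α κ) -
        (n : ℝ) ^ (γ * α) * ((1 - κ) * ∑ j, (max (b j) 0) ^ α)) := by
  have hr : (0 : ℝ) ≤ (n : ℝ) ^ γ := by positivity
  have hmax (j : Fin K) :
      (max (b j * (n : ℝ) ^ γ) 0) ^ α = (max (b j) 0) ^ α * (n : ℝ) ^ (γ * α) := by
    rw [← natCast_rpow_rpow, ← Real.mul_rpow (le_max_right _ _) hr, max_mul_of_nonneg _ _ hr,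
      zero_mul]
  rw [Finset.prod_mul_distrib, ← Real.exp_sum, Finset.prod_const, Finset.card_univ,
    Fintype.card_fin, pow_eq_exp_mul_log (tailConst_pos hc hα hκ0), ← Real.exp_add,
    ← Finset.mul_sum]
  simp only [hmax, ← Finset.sum_mul]
  congr 1
  ring

theorem tilt_mul_scale_eq (hα1 : α < 1) (hγ : γ = 1 / (2 - α)) {n : ℕ} (hn : 0 < n) (t a S d : ℝ) :
    t * ((n : ℝ) ^ γ / n) * (a * (n : ℝ) ^ γ + d - S * (n : ℝ) ^ γ) =
      (n : ℝ) ^ (γ * α) * (t * (a - S)) + t * d * ((n : ℝ) ^ γ / n) := by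
  have hn' : (0 : ℝ) < n := by exact_mod_cast hn
  have hspeed : (n : ℝ) ^ (γ * α) = (n : ℝ) ^ γ * (n : ℝ) ^ γ / n := by
    rw [scale_mul_self hα1 hγ hn, mul_div_cancel_left₀ _ hn'.ne']
  rw [hspeed]
  ring

theorem exists_slack (hα0 : 0 ≤ α) (hα1 : α ≤ 1) {t L : ℝ} {K : ℕ} {x : DecSeq}
    (ht : t * (x.1 (K - 1) : ℝ) ^ (1 - α) < 1 / 2) (hL : L < minorant α v s t K x) :
    ∃ ε : ℝ, 0 < ε ∧ ε < 1 ∧ t * ((x.1 (K - 1) : ℝ) + ε) ^ (1 - α) ≤ 1 / 2 ∧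
      L < (1 - ε) * ∑ j : Fin K, (max ((x.1 j : ℝ) - ε) 0) ^ α +
        (t * (s - ∑ j : Fin K, (x.1 j : ℝ)) - |t| * (K * ε)) - t ^ 2 * v / 2 := by
  have hcont_tilt : Continuous fun ε : ℝ => t * ((x.1 (K - 1) : ℝ) + ε) ^ (1 - α) :=
    ((continuous_const.add continuous_id).rpow_const fun _ => Or.inr (by linarith)).const_mul t
  have hcont_cost : Continuous fun ε : ℝ => (1 - ε) * ∑ j : Fin K, (max ((x.1 j : ℝ) - ε) 0) ^ α +
        (t * (s - ∑ j : Fin K, (x.1 j : ℝ)) - |t| * (K * ε)) - t ^ 2 * v / 2 := by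
    have hpow (j : Fin K) : Continuous fun ε : ℝ => (max ((x.1 j : ℝ) - ε) 0) ^ α :=
      ((continuous_const.sub continuous_id).max continuous_const).rpow_const fun _ => Or.inr hα0
    have := continuous_finsetSum Finset.univ fun j _ => hpow j
    fun_prop
  have htilt : ∀ᶠ ε in 𝓝 (0 : ℝ), t * ((x.1 (K - 1) : ℝ) + ε) ^ (1 - α) < 1 / 2 :=
    hcont_tilt.continuousAt.eventually_lt_const (by simpa using ht)
  have hcost := (hcont_cost.continuousAt (x := 0)).eventually_const_lt (u := L) (by
    have hmax (j : Fin K) : max (x.1 j : ℝ) 0 = x.1 j := by simp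
    simp only [hmax, sub_zero, one_mul, mul_zero]
    rw [Fin.sum_univ_eq_sum_range (fun j => (x.1 j : ℝ) ^ α),
      Fin.sum_univ_eq_sum_range (fun j => (x.1 j : ℝ))]
    exact hL)
  have hunit : ∀ᶠ ε in 𝓝[>] (0 : ℝ), 0 < ε ∧ ε < 1 := Ioo_mem_nhdsGT one_pos
  obtain ⟨ε, ⟨hε0, hε1⟩, hεtilt, hεcost⟩ := (hunit.and ((htilt.and hcost).filter_mono
    nhdsWithin_le_nhds)).exists
  exact ⟨ε, hε0, hε1, hεtilt.le, hεcost⟩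

/-- Logarithm, divided by `n ^ (γ * α)`, of the bound for the probability of `K` jumps at any
positions: `a` is the total jump cost, `q n` the value of the exponential Chebyshev exponent for the
remaining variables, and `δ` their truncation level in units of `n ^ γ`. -/
noncomputable def jumpExponent (α c μ γ κ δ t a : ℝ) (K : ℕ) (q : ℕ → ℝ) (n : ℕ) : ℝ :=
  K * (Real.log n / (n : ℝ) ^ (γ * α)) + K * Real.log (tailConst c α κ) * ((n : ℝ) ^ (γ * α))⁻¹ -
    a - q n + ((n - K : ℕ) : ℝ) / (n : ℝ) ^ (γ * α) *
    Real.log (truncMGF (stretchedExp c α) μ (δ * (n : ℝ) ^ γ) (t * ((n : ℝ) ^ γ / n)))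

theorem IsStretchedExpLaw.tendsto_jumpExponent (h : IsStretchedExpLaw α c μ v)
    (hγ : γ = 1 / (2 - α)) {δ t : ℝ} (hδ : 0 < δ) (ht : t * δ ^ (1 - α) ≤ 1 / 2) (κ a : ℝ) (K : ℕ)
    {q : ℕ → ℝ} {q' : ℝ} (hq : Tendsto q atTop (𝓝 q')) :
    Tendsto (jumpExponent α c μ γ κ δ t a K q) atTop (𝓝 (t ^ 2 * v / 2 - a - q')) := by
  have hspeed := (tendsto_speed h.alpha_pos h.alpha_lt_one hγ).inv_tendsto_atTop
  have hlog := tendsto_log_div_speed h.alpha_pos h.alpha_lt_one hγ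
  have hsum := (((((hlog.const_mul (K : ℝ)).add (hspeed.const_mul
    (K * Real.log (tailConst c α κ)))).sub_const a).sub hq)).add
    (h.tendsto_log_truncMGF hγ hδ ht K)
  have hvalue : t ^ 2 * v / 2 - a - q' =
      K * 0 + K * Real.log (tailConst c α κ) * 0 - a - q' + t ^ 2 * v / 2 := by ring
  rw [hvalue]
  exact hsum

theorem IsStretchedExpLaw.jump_bound_eq_exp (h : IsStretchedExpLaw α c μ v) (hκ0 : 0 < κ)
    {δ t : ℝ} (hδ : 0 < δ) {K : ℕ} (b : Fin K → ℝ) (q : ℕ → ℝ) {n : ℕ} (hn : 0 < n) :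
    (n : ℝ) ^ K *
      ((∏ j, tailConst c α κ * Real.exp (-(1 - κ) * (max (b j * (n : ℝ) ^ γ) 0) ^ α)) *
      (Real.exp (-((n : ℝ) ^ (γ * α) * q n)) * truncMGF (stretchedExp c α) μ (δ * (n : ℝ) ^ γ)
        (t * ((n : ℝ) ^ γ / n)) ^ (n - K))) =
    Real.exp ((n : ℝ) ^ (γ * α) *
      jumpExponent α c μ γ κ δ t ((1 - κ) * ∑ j, (max (b j) 0) ^ α) K q n) := by
  have hn' : (0 : ℝ) < n := by exact_mod_cast hn
  have : (0 : ℝ) < (n : ℝ) ^ (γ * α) := by positivity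
  rw [prod_tailConst_mul_exp h.c_pos h.alpha_pos hκ0, pow_eq_exp_mul_log hn',
    pow_eq_exp_mul_log (truncMGF_pos h.nonneg (h.stretchedExp_pos 0) (by positivity) _),
    ← Real.exp_add, ← Real.exp_add, ← Real.exp_add, jumpExponent]
  congr 1
  field_simp
  ring

theorem eventually_forall_abs_sub_le (x : DecSeq) (K : ℕ) {ε : ℝ} (hε : 0 < ε) :
    ∀ᶠ y : DecSeq in 𝓝 x, ∀ j < K, |(y.1 j : ℝ) - x.1 j| ≤ ε := by
  refine (eventually_all_finite (Set.finite_Iio K)).mpr fun j _ => ?_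
  have hcont : Continuous fun y : DecSeq => |(y.1 j : ℝ) - x.1 j| :=
    ((continuous_coe_apply j).sub continuous_const).abs
  exact hcont.continuousAt.eventually_le_const (by simpa using hε)

theorem sum_sub_eq_of_sum_eq {n : ℕ} {x : ℕ → ℕ} {d : ℝ}
    (hx : ((∑ i ∈ Finset.range n, x i : ℕ) : ℝ) = μ * n + d) :
    ∑ i ∈ Finset.range n, ((x i : ℝ) - μ) = d := by
  rw [Finset.sum_sub_distrib, ← Nat.cast_sum, hx, Finset.sum_const, Finset.card_range,
    nsmul_eq_mul]
  ring

theorem IsStretchedExpLaw.measure_sum_eq_and_abs_sub_le_le (h : IsStretchedExpLaw α c μ v)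
    (hX : IsIIDWithMass P X (stretchedExp c α)) (hγ : γ = 1 / (2 - α)) (t : ℝ) {ε : ℝ}
    (hε0 : 0 < ε) (hε1 : ε ≤ 1) {n K : ℕ} (hK : 1 ≤ K) (hKn : K ≤ n) (sn : ℕ → ℝ) (x : DecSeq) :
    P {ω | ((∑ i ∈ Finset.range n, X i ω : ℕ) : ℝ) = μ * n + sn n * (n : ℝ) ^ γ ∧
        ∀ j < K, |((scaledOrderStats γ (fun i : Fin n => X i ω)).1 j : ℝ) - x.1 j| ≤ ε} ≤
      ENNReal.ofReal (Real.exp ((n : ℝ) ^ (γ * α) * jumpExponent α c μ γ ε (x.1 (K - 1) + ε) t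
        ((1 - ε) * ∑ j : Fin K, (max ((x.1 j : ℝ) - ε) 0) ^ α) K
        (fun n => t * (sn n - ∑ j : Fin K, (x.1 j : ℝ)) - |t| * (K * ε) +
          t * (K * μ) * (((n : ℝ) ^ γ / n) * ((n : ℝ) ^ (γ * α))⁻¹)) n)) := by
  have hn : 0 < n := hK.trans hKn
  have : (0 : ℝ) < n := by exact_mod_cast hn
  have : (0 : ℝ) < (n : ℝ) ^ (γ * α) := by positivity
  rw [← h.jump_bound_eq_exp hε0 (add_pos_of_nonneg_of_pos (x.1 (K - 1)).coe_nonneg hε0) _ _ hn]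
  refine le_trans (measure_mono ?_) (hX.measure_exists_hasJumpsAt_le h.c_pos.le h.alpha_pos hε0 hε1
    μ _ _ _ n _)
  rintro ω ⟨hsum, hclose⟩
  obtain ⟨e, he⟩ := exists_hasJumpsAt_of_abs_sub_le hK hKn μ (t * ((n : ℝ) ^ γ / n)) hclose
  rw [← Finset.sum_range (fun i => (X i ω : ℝ) - μ), sum_sub_eq_of_sum_eq hsum] at he
  refine ⟨e, he.injective, he.le_apply, he.apply_le, le_of_eq_of_le ?_ he.le_mul_sum⟩
  have habs := tilt_mul_scale_eq h.alpha_lt_one hγ hn |t| (K * ε) 0 0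
  have hcancel : (n : ℝ) ^ (γ * α) * (((n : ℝ) ^ γ / n) * ((n : ℝ) ^ (γ * α))⁻¹) =
      (n : ℝ) ^ γ / n := by field_simp
  rw [tilt_mul_scale_eq h.alpha_lt_one hγ hn, abs_mul,
    abs_of_nonneg (by positivity : 0 ≤ (n : ℝ) ^ γ / n)]
  linear_combination t * (K * μ) * hcancel + habs

theorem IsStretchedExpLaw.exists_nhds_measure_le (h : IsStretchedExpLaw α c μ v)
    (hX : IsIIDWithMass P X (stretchedExp c α)) (hγ : γ = 1 / (2 - α)) {sn : ℕ → ℝ}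
    (hsn : Tendsto sn atTop (𝓝 s)) {x : DecSeq} {L : ℝ≥0} (hL : L < energy α v s x) :
    ∃ U ∈ 𝓝 x, ∀ᶠ n : ℕ in atTop,
      P {ω | ((∑ i ∈ Finset.range n, X i ω : ℕ) : ℝ) = μ * n + sn n * (n : ℝ) ^ γ ∧
        scaledOrderStats γ (fun i : Fin n => X i ω) ∈ U} ≤
      ENNReal.ofReal (Real.exp (-((n : ℝ) ^ (γ * α) * L))) := by
  obtain ⟨t, K, hK, ht, hm⟩ := exists_lt_minorant h.alpha_pos h.alpha_lt_one h.var_pos hL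
  obtain ⟨ε, hε0, hε1, hεt, hεL⟩ := exists_slack h.alpha_pos.le h.alpha_lt_one.le ht hm
  refine ⟨_, eventually_forall_abs_sub_le x K hε0, ?_⟩
  have hspeed := (tendsto_speed h.alpha_pos h.alpha_lt_one hγ).inv_tendsto_atTop
  have hexponent := h.tendsto_jumpExponent hγ
    (add_pos_of_nonneg_of_pos (x.1 (K - 1)).coe_nonneg hε0) hεt ε
    ((1 - ε) * ∑ j : Fin K, (max ((x.1 j : ℝ) - ε) 0) ^ α) K
    ((((hsn.sub_const (∑ j : Fin K, (x.1 j : ℝ))).const_mul t).sub_const (|t| * (K * ε))).add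
      (((tendsto_scale_div h.alpha_lt_one hγ).mul hspeed).const_mul (t * (K * μ))))
  filter_upwards [hexponent.eventually_lt_const (u := -(L : ℝ)) (by linarith),
    eventually_ge_atTop K] with n hn hKn
  refine (h.measure_sum_eq_and_abs_sub_le_le hX hγ t hε0 hε1.le hK hKn sn x).trans ?_
  rw [← mul_neg]
  gcongr
  exact hn.le

theorem IsIIDWithMass.measure_largest_gt_le (h : IsIIDWithMass P X (stretchedExp c α))
    (hc : 0 ≤ c) (hα : 0 < α) (hκ0 : 0 < κ) (hκ1 : κ ≤ 1) (γ : ℝ) (M : ℝ≥0) {n : ℕ} (hn : 0 < n) :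
    P {ω | M < (scaledOrderStats γ (fun i : Fin n => X i ω)).1 0} ≤
      ENNReal.ofReal (n * (tailConst c α κ *
        Real.exp (-((n : ℝ) ^ (γ * α) * ((1 - κ) * (M : ℝ) ^ α))))) := by
  have hr : (0 : ℝ) < (n : ℝ) ^ γ := by positivity
  have hsub : {ω | M < (scaledOrderStats γ (fun i : Fin n => X i ω)).1 0} ⊆
      ⋃ i : Fin n, {ω | M * (n : ℝ) ^ γ ≤ X i ω} := by
    intro ω (hω : M < _)
    obtain ⟨ρ, hρ⟩ := exists_perm_revOrderStat fun i : Fin n => X i ω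
    have hlt := NNReal.coe_lt_coe.mpr hω
    rw [coe_scaledOrderStats, lt_div_iff₀ hr] at hlt
    refine Set.mem_iUnion.mpr ⟨ρ ⟨0, hn⟩, hlt.le.trans_eq ?_⟩
    rw [hρ ⟨0, hn⟩]
  refine (measure_mono hsub).trans ((measure_iUnion_fintype_le P _).trans ?_)
  refine (Finset.sum_le_sum fun (i : Fin n) _ =>
    h.measure_ge_le hc hα hκ0 hκ1 (M * (n : ℝ) ^ γ) (i : ℕ)).trans_eq ?_
  rw [Finset.sum_const, Finset.card_univ, Fintype.card_fin, nsmul_eq_mul,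
    ENNReal.ofReal_mul n.cast_nonneg, ENNReal.ofReal_natCast, max_eq_left (by positivity),
    Real.mul_rpow M.coe_nonneg hr.le, natCast_rpow_rpow]
  congr 4
  ring

theorem IsIIDWithMass.exists_measure_largest_gt_le (h : IsIIDWithMass P X (stretchedExp c α))
    (hc : 0 < c) (hα0 : 0 < α) (hα1 : α < 1) (hγ : γ = 1 / (2 - α)) (L : ℝ≥0) :
    ∃ M : ℝ≥0, ∀ᶠ n : ℕ in atTop,
      P {ω | M < (scaledOrderStats γ (fun i : Fin n => X i ω)).1 0} ≤
        ENNReal.ofReal (Real.exp (-((n : ℝ) ^ (γ * α) * L))) := by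
  set M : ℝ≥0 := (2 * (L + 1)) ^ α⁻¹ with hM
  have hMα : (1 - 1 / 2) * (M : ℝ) ^ α = L + 1 := by
    rw [← NNReal.coe_rpow, hM, NNReal.rpow_inv_rpow hα0.ne']
    push_cast
    ring
  set C : ℝ := tailConst c α (1 / 2)
  have hC : 0 < C := tailConst_pos hc hα0 (by norm_num)
  have hlim : Tendsto (fun n : ℕ => Real.log n / (n : ℝ) ^ (γ * α) +
      Real.log C * ((n : ℝ) ^ (γ * α))⁻¹) atTop (𝓝 (0 + Real.log C * 0)) :=
    (tendsto_log_div_speed hα0 hα1 hγ).add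
      ((tendsto_speed hα0 hα1 hγ).inv_tendsto_atTop.const_mul _)
  refine ⟨M, ?_⟩
  filter_upwards [hlim.eventually_le_const (u := 1) (by norm_num), eventually_gt_atTop 0]
    with n hle hn
  have hn' : (0 : ℝ) < n := by exact_mod_cast hn
  refine (h.measure_largest_gt_le hc.le hα0 (κ := 1 / 2) (by norm_num) (by norm_num) γ M hn).trans
    ?_
  set V : ℝ := (n : ℝ) ^ (γ * α)
  have hV : 0 < V := by positivity
  rw [hMα]
  refine ENNReal.ofReal_le_ofReal ?_
  calc n * (C * Real.exp (-(V * (L + 1))))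
      = Real.exp (V * (Real.log n / V + Real.log C * V⁻¹) - V * (L + 1)) := by
        have hlogs : V * (Real.log n / V + Real.log C * V⁻¹) = Real.log n + Real.log C := by
          field_simp
        rw [hlogs, Real.exp_sub, Real.exp_add, Real.exp_log hn', Real.exp_log hC, Real.exp_neg,
          div_eq_mul_inv, mul_assoc]
    _ ≤ Real.exp (V * 1 - V * (L + 1)) := by gcongr
    _ = Real.exp (-(V * L)) := by ring_nf

end UpperBound

/-! ### The lower bound -/

section Window

variable {Ω : Type*} [MeasurableSpace Ω] {P : Measure Ω} {α c μ v γ : ℝ} {X : ℕ → Ω → ℕ}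

theorem eventually_le_exp_speed_mul (hα0 : 0 < α) (hα1 : α < 1) (hγ : γ = 1 / (2 - α)) {d : ℝ}
    (hd : 0 < d) (C : ℝ) : ∀ᶠ n : ℕ in atTop, C ≤ Real.exp ((n : ℝ) ^ (γ * α) * d) :=
  (Real.tendsto_exp_atTop.comp
    ((tendsto_speed hα0 hα1 hγ).atTop_mul_const hd)).eventually_ge_atTop C

theorem scale_mul_scale_div (hα1 : α < 1) (hγ : γ = 1 / (2 - α)) {n : ℕ} (hn : 0 < n) :
    (n : ℝ) ^ γ * ((n : ℝ) ^ γ / n) = (n : ℝ) ^ (γ * α) := by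
  have : (0 : ℝ) < n := by exact_mod_cast hn
  rw [← mul_div_assoc, scale_mul_self hα1 hγ hn]
  field_simp

theorem IsStretchedExpLaw.eventually_truncMGF_pow_mem_Icc (h : IsStretchedExpLaw α c μ v)
    (hγ : γ = 1 / (2 - α)) {η t ε : ℝ} (hη : 0 < η) (ht : t * η ^ (1 - α) ≤ 1 / 2) (K : ℕ)
    (hε : 0 < ε) :
    ∀ᶠ n : ℕ in atTop,
      truncMGF (stretchedExp c α) μ (η * (n : ℝ) ^ γ) (t * ((n : ℝ) ^ γ / n)) ^ (n - K) ∈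
        Set.Icc (Real.exp ((n : ℝ) ^ (γ * α) * (t ^ 2 * v / 2 - ε)))
          (Real.exp ((n : ℝ) ^ (γ * α) * (t ^ 2 * v / 2 + ε))) := by
  have hlim := h.tendsto_log_truncMGF hγ hη ht K
  filter_upwards [hlim.eventually_const_le (u := t ^ 2 * v / 2 - ε) (by linarith),
    hlim.eventually_le_const (u := t ^ 2 * v / 2 + ε) (by linarith), eventually_gt_atTop 0]
    with n hlow hup hn
  have : (0 : ℝ) < n := by exact_mod_cast hn
  set V : ℝ := (n : ℝ) ^ (γ * α)
  set φ := truncMGF (stretchedExp c α) μ (η * (n : ℝ) ^ γ) (t * ((n : ℝ) ^ γ / n))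
  have hV : 0 < V := by positivity
  have hφ : 0 < φ := truncMGF_pos h.nonneg (h.stretchedExp_pos 0) (by positivity) _
  have hpow : φ ^ (n - K) = Real.exp (V * (((n - K : ℕ) : ℝ) / V * Real.log φ)) := by
    rw [pow_eq_exp_mul_log hφ]
    congr 1
    field_simp
  rw [hpow]
  exact ⟨by gcongr, by gcongr⟩

theorem tilt_mul_le_of_mem_Icc {r ρ u ζ z : ℝ} (hρ : 0 ≤ ρ) (t : ℝ)
    (hz : z ∈ Set.Icc ((u - ζ) * r) ((u + ζ) * r)) :
    t * ρ * z ≤ r * ρ * (t * u + |t| * ζ) := by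
  have hdist : |z - u * r| ≤ ζ * r := by
    rw [abs_le]
    constructor <;> linarith [hz.1, hz.2]
  have hdev : t * (z - u * r) ≤ |t| * (ζ * r) := by
    refine (le_abs_self _).trans ?_
    rw [abs_mul]
    gcongr
  calc t * ρ * z = ρ * (t * (z - u * r) + t * (u * r)) := by ring
    _ ≤ ρ * (|t| * (ζ * r) + t * (u * r)) := by gcongr
    _ = r * ρ * (t * u + |t| * ζ) := by ring

theorem IsStretchedExpLaw.eventually_exp_le_window_add [IsFiniteMeasure P]
    (h : IsStretchedExpLaw α c μ v) (hX : IsIIDWithMass P X (stretchedExp c α))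
    (hγ : γ = 1 / (2 - α)) {t κ η ε : ℝ} (hκ : 0 < κ) (hη : 0 < η)
    (htη : (|t| + κ) * η ^ (1 - α) ≤ 1 / 2) (K : ℕ) (hε : 0 < ε) :
    ∀ᶠ n : ℕ in atTop,
      Real.exp ((n : ℝ) ^ (γ * α) * (t ^ 2 * v / 2 - ε)) ≤
        Real.exp ((n : ℝ) ^ (γ * α) * (t * (t * v) + |t| * (κ * v))) *
          P.real {ω | (fun i => X i ω) ∈ truncWindow (Finset.Ico K n) μ (η * (n : ℝ) ^ γ)
            ((t * v - κ * v) * (n : ℝ) ^ γ) ((t * v + κ * v) * (n : ℝ) ^ γ)} +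
        2 * Real.exp ((n : ℝ) ^ (γ * α) * (t ^ 2 * v / 2 - κ ^ 2 * v / 2 + ε)) := by
  have htilt (a : ℝ) (ha : a ≤ |t| + κ) : a * η ^ (1 - α) ≤ 1 / 2 :=
    (mul_le_mul_of_nonneg_right ha (by positivity)).trans htη
  have htabs := le_abs_self t
  filter_upwards [h.eventually_truncMGF_pow_mem_Icc hγ hη (htilt t (by linarith)) K hε,
    h.eventually_truncMGF_pow_mem_Icc hγ hη (htilt (t + κ) (by linarith)) K hε,
    h.eventually_truncMGF_pow_mem_Icc hγ hη (htilt (t - κ) (by linarith)) K hε,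
    eventually_gt_atTop 0] with n hmid hright hleft hn
  have hV := scale_mul_scale_div h.alpha_lt_one hγ hn
  set r : ℝ := (n : ℝ) ^ γ
  set V : ℝ := (n : ℝ) ^ (γ * α)
  have hρ : 0 ≤ r / n := by positivity
  have hsplit := hX.truncMGF_pow_le μ (η * r) (θ := t * (r / n)) (τ := κ * (r / n))
    (by positivity) (fun z hz => tilt_mul_le_of_mem_Icc hρ t hz) (Finset.Ico K n)
    (a := (t * v - κ * v) * r) (b := (t * v + κ * v) * r)
  rw [Nat.card_Ico, ← add_mul t κ (r / n), ← sub_mul t κ (r / n), hV] at hsplit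
  refine hmid.1.trans (hsplit.trans ?_)
  have hright' : Real.exp (-(κ * (r / n) * ((t * v + κ * v) * r))) *
      truncMGF (stretchedExp c α) μ (η * r) ((t + κ) * (r / n)) ^ (n - K) ≤
      Real.exp (V * (t ^ 2 * v / 2 - κ ^ 2 * v / 2 + ε)) := by
    refine (mul_le_mul_of_nonneg_left hright.2 (Real.exp_pos _).le).trans_eq ?_
    rw [← Real.exp_add, ← hV]
    ring_nf
  have hleft' : Real.exp (κ * (r / n) * ((t * v - κ * v) * r)) *
      truncMGF (stretchedExp c α) μ (η * r) ((t - κ) * (r / n)) ^ (n - K) ≤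
      Real.exp (V * (t ^ 2 * v / 2 - κ ^ 2 * v / 2 + ε)) := by
    refine (mul_le_mul_of_nonneg_left hleft.2 (Real.exp_pos _).le).trans_eq ?_
    rw [← Real.exp_add, ← hV]
    ring_nf
  linarith

theorem exp_neg_le_of_exp_le_add {V a D ε w p : ℝ} (hV : 0 ≤ V)
    (hmain : Real.exp (V * (a - min (ε / 2) (D / 4))) ≤
      Real.exp (V * w) * p + 2 * Real.exp (V * (a - D + min (ε / 2) (D / 4))))
    (hD : 4 ≤ Real.exp (V * (D / 2))) (hε : 2 ≤ Real.exp (V * (ε / 2))) :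
    Real.exp (-(V * (w - a + ε))) ≤ p := by
  set δ := min (ε / 2) (D / 4)
  have hδε : δ ≤ ε / 2 := min_le_left _ _
  have hδD : δ ≤ D / 4 := min_le_right _ _
  have hsmall : Real.exp (V * (a - D + δ)) * 4 ≤ Real.exp (V * (a - δ)) := by
    calc Real.exp (V * (a - D + δ)) * 4
        ≤ Real.exp (V * (a - D + δ)) * Real.exp (V * (D / 2)) := by gcongr
      _ = Real.exp (V * (a - D + δ + D / 2)) := by rw [← Real.exp_add, mul_add V _ (D / 2)]
      _ ≤ Real.exp (V * (a - δ)) := by gcongr; linarith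
  have hlarge : Real.exp (V * w) * Real.exp (-(V * (w - a + ε))) * 2 ≤ Real.exp (V * (a - δ)) := by
    calc Real.exp (V * w) * Real.exp (-(V * (w - a + ε))) * 2
        ≤ Real.exp (V * w) * Real.exp (-(V * (w - a + ε))) * Real.exp (V * (ε / 2)) := by gcongr
      _ = Real.exp (V * (a - ε / 2)) := by rw [← Real.exp_add, ← Real.exp_add]; ring_nf
      _ ≤ Real.exp (V * (a - δ)) := by gcongr
  exact le_of_mul_le_mul_left (by linarith) (Real.exp_pos (V * w))

theorem IsStretchedExpLaw.eventually_exp_le_measure_truncWindow [IsFiniteMeasure P]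
    (h : IsStretchedExpLaw α c μ v) (hX : IsIIDWithMass P X (stretchedExp c α))
    (hγ : γ = 1 / (2 - α)) {u ζ η ε : ℝ} (hζ : 0 < ζ) (hη : 0 < η)
    (huη : (|u| + ζ) / v * η ^ (1 - α) ≤ 1 / 2) (K : ℕ) (hε : 0 < ε) :
    ∀ᶠ n : ℕ in atTop,
      Real.exp (-((n : ℝ) ^ (γ * α) * (u ^ 2 / (2 * v) + |u| / v * ζ + ε))) ≤
        P.real {ω | (fun i => X i ω) ∈ truncWindow (Finset.Ico K n) μ (η * (n : ℝ) ^ γ)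
          ((u - ζ) * (n : ℝ) ^ γ) ((u + ζ) * (n : ℝ) ^ γ)} := by
  have hv := h.var_pos
  have habs : |u / v| = |u| / v := by rw [abs_div, abs_of_pos hv]
  have hD : 0 < (ζ / v) ^ 2 * v / 2 := by positivity
  have hwindow := h.eventually_exp_le_window_add hX hγ (t := u / v) (κ := ζ / v)
    (ε := min (ε / 2) ((ζ / v) ^ 2 * v / 2 / 4)) (by positivity) hη
    (by rwa [habs, ← add_div]) K (by positivity)
  have hspeed {d : ℝ} (hd : 0 < d) (C : ℝ) :=
    eventually_le_exp_speed_mul h.alpha_pos h.alpha_lt_one hγ hd C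
  filter_upwards [hwindow, hspeed (half_pos hD) 4, hspeed (half_pos hε) 2] with n hn h4 h2
  have hp := exp_neg_le_of_exp_le_add (by positivity) hn h4 h2
  rw [habs, div_mul_cancel₀ u hv.ne', div_mul_cancel₀ ζ hv.ne'] at hp
  have hexponent :
      u / v * u + |u| / v * ζ - (u / v) ^ 2 * v / 2 = u ^ 2 / (2 * v) + |u| / v * ζ := by
    field_simp
    ring
  rwa [hexponent] at hp

end Window

section LowerBound

variable {Ω : Type*} [MeasurableSpace Ω] {P : Measure Ω} {α c μ v γ s : ℝ} {X : ℕ → Ω → ℕ}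

theorem sum_range_eq_of_prefix {K n N : ℕ} (hKn : K < n) {k z : ℕ → ℕ}
    (hprefix : ∀ i ∈ Finset.range K, z i = k i)
    (hle : ∑ i ∈ Finset.range K, k i + ∑ i ∈ Finset.Ico (K + 1) n, z i ≤ N)
    (hfill : z K = N - (∑ i ∈ Finset.range K, k i + ∑ i ∈ Finset.Ico (K + 1) n, z i)) :
    ∑ i ∈ Finset.range n, z i = N := by
  have hsum : ∑ i ∈ Finset.range K, z i = ∑ i ∈ Finset.range K, k i :=
    Finset.sum_congr rfl hprefix
  rw [← Finset.sum_range_add_sum_Ico z (show K + 1 ≤ n from hKn), Finset.sum_range_succ, hsum,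
    hfill]
  omega

theorem IsIIDWithMass.prod_mul_le_measure_sum_eq {p : ℕ → ℝ} (h : IsIIDWithMass P X p)
    {K n D N : ℕ} (hKn : K < n) (hp : ∀ d ≤ D, p D ≤ p d) (k : ℕ → ℕ) {q : (ℕ → ℕ) → Prop}
    (hq : DependsOn q (Finset.Ico (K + 1) n))
    (hlow : ∀ z, q z → ∑ i ∈ Finset.range K, k i + ∑ i ∈ Finset.Ico (K + 1) n, z i ≤ N)
    (hup : ∀ z, q z → N ≤ ∑ i ∈ Finset.range K, k i + ∑ i ∈ Finset.Ico (K + 1) n, z i + D) :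
    (∏ i ∈ Finset.range K, ENNReal.ofReal (p (k i))) *
        (ENNReal.ofReal (p D) * P {ω | q fun i => X i ω}) ≤
      P {ω | (∀ i ∈ Finset.range K, X i ω = k i) ∧ X K ω ≤ D ∧ (q fun i => X i ω) ∧
        ∑ i ∈ Finset.range n, X i ω = N} := by
  set f : (ℕ → ℕ) → ℕ := fun z =>
    N - (∑ i ∈ Finset.range K, k i + ∑ i ∈ Finset.Ico (K + 1) n, z i) with hfdef
  have hf : DependsOn f (Finset.Ico (K + 1) n) := fun z z' hz => by
    simp only [hfdef, Finset.sum_congr rfl hz]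
  have hfD (z : ℕ → ℕ) (hz : q z) : f z ≤ D := by
    have := hup z hz
    simp only [hfdef]
    omega
  have hfill : DependsOn (fun z => q z ∧ z K = f z) (Finset.Ico K n) := fun z z' hz => by
    have hz' (i : ℕ) (hi : i ∈ Finset.Ico (K + 1) n) : z i = z' i :=
      hz i (Finset.Ico_subset_Ico_left K.le_succ hi)
    simp only [hq hz', hf hz', hz K (Finset.left_mem_Ico.mpr hKn)]
  have hdisj : Disjoint (Finset.range K) (Finset.Ico K n) := by
    rw [Finset.range_eq_Ico]
    exact Finset.Ico_disjoint_Ico_consecutive 0 K n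
  have hprefix := dependsOn_forall_mem (Finset.range K) fun i => {k i}
  calc (∏ i ∈ Finset.range K, ENNReal.ofReal (p (k i))) *
        (ENNReal.ofReal (p D) * P {ω | q fun i => X i ω})
      ≤ P {ω | ∀ i ∈ Finset.range K, X i ω ∈ ({k i} : Set ℕ)} *
          P {ω | (q fun i => X i ω) ∧ X K ω = f fun i => X i ω} := by
        rw [measure_forall_mem_eq_prod h.indep]
        refine mul_le_mul' (Finset.prod_le_prod' fun i _ => (h.law i (k i)).ge) ?_
        refine mul_measure_le_measure_and_eq h.measurable h.indep (by simp) hq hf hfD fun d hd => ?_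
        exact (ENNReal.ofReal_le_ofReal (hp d hd)).trans_eq (h.law K d).symm
    _ = P {ω | (∀ i ∈ Finset.range K, X i ω ∈ ({k i} : Set ℕ)) ∧ (q fun i => X i ω) ∧
          X K ω = f fun i => X i ω} :=
        (measure_and_eq_mul_of_dependsOn h.measurable h.indep hdisj hprefix hfill).symm
    _ ≤ _ := by
        refine measure_mono ?_
        rintro ω ⟨hk, hqω, hK⟩
        exact ⟨hk, hK.trans_le (hfD _ hqω), hqω, sum_range_eq_of_prefix hKn hk (hlow _ hqω) hK⟩

theorem exists_window_width (hα0 : 0 < α) {T A L η₀ : ℝ} (hη₀ : 0 < η₀)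
    (hL : A + T ^ 2 / (2 * v) < L) :
    ∃ ζ : ℝ, 0 < ζ ∧ 4 * ζ ≤ η₀ ∧
      A + (4 * ζ) ^ α + ((T - 2 * ζ) ^ 2 / (2 * v) + |T - 2 * ζ| / v * ζ) < L := by
  have hcont : Continuous fun ζ : ℝ =>
      A + (4 * ζ) ^ α + ((T - 2 * ζ) ^ 2 / (2 * v) + |T - 2 * ζ| / v * ζ) := by
    have : Continuous fun ζ : ℝ => (4 * ζ) ^ α :=
      (continuous_const.mul continuous_id).rpow_const fun _ => Or.inr hα0.le
    fun_prop
  have hlt := (hcont.continuousAt (x := 0)).eventually_lt_const (u := L) (by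
    simpa [Real.zero_rpow hα0.ne'] using hL)
  have hsmall : ∀ᶠ ζ in 𝓝[>] (0 : ℝ), ζ ∈ Set.Ioo 0 (η₀ / 4) := Ioo_mem_nhdsGT (by positivity)
  obtain ⟨ζ, ⟨hζ, hζη⟩, hζL⟩ := (hsmall.and (hlt.filter_mono nhdsWithin_le_nhds)).exists
  exact ⟨ζ, hζ, by linarith, hζL⟩

theorem exists_truncation_level (hα1 : α < 1) (a : ℝ) {η₀ : ℝ} (hη₀ : 0 < η₀) :
    ∃ η : ℝ, 0 < η ∧ η ≤ η₀ ∧ a * η ^ (1 - α) ≤ 1 / 2 := by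
  have hcont : Continuous fun η : ℝ => a * η ^ (1 - α) :=
    (continuous_id.rpow_const fun _ => Or.inr (by linarith)).const_mul a
  have hlt := (hcont.continuousAt (x := 0)).eventually_lt_const (u := 1 / 2) (by
    simp [Real.zero_rpow (sub_pos.mpr hα1).ne'])
  have hsmall : ∀ᶠ η in 𝓝[>] (0 : ℝ), η ∈ Set.Ioo 0 η₀ := Ioo_mem_nhdsGT hη₀
  obtain ⟨η, ⟨hη, hηη₀⟩, hηa⟩ := (hsmall.and (hlt.filter_mono nhdsWithin_le_nhds)).exists
  exact ⟨η, hη, hηη₀.le, hηa.le⟩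

theorem abs_scaledOrderStats_sub_truncate_le {n K : ℕ} (hn : 0 < n) (hKn : K ≤ n) {z : Fin n → ℕ}
    {x : DecSeq} {η : ℝ} (hη : 0 ≤ η)
    (h : ∀ i : Fin n, |(z i : ℝ) - (x.truncate K).1 i * (n : ℝ) ^ γ| ≤ η * (n : ℝ) ^ γ) (j : ℕ) :
    |((scaledOrderStats γ z).1 j : ℝ) - (x.truncate K).1 j| ≤ η := by
  have : (0 : ℝ) < n := by exact_mod_cast hn
  have hr : 0 < (n : ℝ) ^ γ := by positivity
  rw [coe_scaledOrderStats]
  by_cases hj : j < n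
  · have hanti : Antitone fun j => ((x.truncate K).1 j : ℝ) * (n : ℝ) ^ γ := fun i j hij =>
      mul_le_mul_of_nonneg_right (NNReal.coe_le_coe.mpr ((x.truncate K).2 hij)) hr.le
    have hdist := abs_revOrderStat_sub_le z hanti h ⟨j, hj⟩
    rwa [← mul_le_mul_iff_of_pos_right hr, ← abs_of_pos hr, ← abs_mul, abs_of_pos hr, sub_mul,
      div_mul_cancel₀ _ hr.ne']
  · rw [revOrderStat, dif_neg hj, x.truncate_of_le (by omega)]
    simpa using hη

theorem sum_floor_le_sum {ι : Type*} (J : Finset ι) {a : ι → ℝ} (ha : ∀ i ∈ J, 0 ≤ a i) :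
    ((∑ i ∈ J, ⌊a i⌋₊ : ℕ) : ℝ) ≤ ∑ i ∈ J, a i := by
  rw [Nat.cast_sum]
  exact Finset.sum_le_sum fun i hi => Nat.floor_le (ha i hi)

theorem sum_le_sum_floor_add_card {ι : Type*} (J : Finset ι) (a : ι → ℝ) :
    ∑ i ∈ J, a i ≤ ((∑ i ∈ J, ⌊a i⌋₊ : ℕ) : ℝ) + J.card := by
  calc ∑ i ∈ J, a i ≤ ∑ i ∈ J, ((⌊a i⌋₊ : ℝ) + 1) :=
        Finset.sum_le_sum fun i _ => (Nat.lt_floor_add_one _).le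
    _ = _ := by rw [Finset.sum_add_distrib, Nat.cast_sum, Finset.sum_const, nsmul_one]

theorem sum_bounds_of_mem_truncWindow {K n N : ℕ} (hKn : K < n) {x : ℕ → ℝ≥0} {r σ ζ B : ℝ}
    (hr : 0 ≤ r) (hN : μ * n + σ * r = N)
    (hcenter : |σ - s| * r + (K + |μ| * (K + 1)) ≤ ζ * r) {z : ℕ → ℕ}
    (hz : z ∈ truncWindow (Finset.Ico (K + 1) n) μ B
      ((s - ∑ j ∈ Finset.range K, (x j : ℝ) - 2 * ζ - ζ) * r)
      ((s - ∑ j ∈ Finset.range K, (x j : ℝ) - 2 * ζ + ζ) * r)) :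
    ∑ i ∈ Finset.range K, ⌊x i * r⌋₊ + ∑ i ∈ Finset.Ico (K + 1) n, z i ≤ N ∧
      N ≤ ∑ i ∈ Finset.range K, ⌊x i * r⌋₊ + ∑ i ∈ Finset.Ico (K + 1) n, z i + ⌊4 * ζ * r⌋₊ := by
  obtain ⟨-, hlow, hup⟩ := hz
  rw [Finset.sum_sub_distrib, Finset.sum_const, Nat.card_Ico, nsmul_eq_mul, Nat.cast_sub hKn,
    ← Nat.cast_sum, Nat.cast_add_one] at hlow hup
  have hμ : |μ * (K + 1)| ≤ |μ| * (K + 1) := by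
    rw [abs_mul, abs_of_nonneg (by positivity : (0 : ℝ) ≤ K + 1)]
  have hσ : |(σ - s) * r| ≤ |σ - s| * r := by rw [abs_mul, abs_of_nonneg hr]
  obtain ⟨hμ_low, hμ_up⟩ := abs_le.mp hμ
  obtain ⟨hσ_low, hσ_up⟩ := abs_le.mp hσ
  have hfloor := sum_floor_le_sum (Finset.range K) (a := fun i => x i * r) fun i _ => by positivity
  have hfloor' := sum_le_sum_floor_add_card (Finset.range K) fun i => x i * r
  rw [← Finset.sum_mul] at hfloor hfloor'
  rw [Finset.card_range] at hfloor'
  have hle : ∑ i ∈ Finset.range K, ⌊x i * r⌋₊ + ∑ i ∈ Finset.Ico (K + 1) n, z i ≤ N := by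
    rw [← Nat.cast_le (α := ℝ), Nat.cast_add, ← hN]
    linarith
  refine ⟨hle, ?_⟩
  rw [add_comm _ ⌊_⌋₊, ← tsub_le_iff_right]
  refine Nat.le_floor ?_
  rw [Nat.cast_sub hle, Nat.cast_add, ← hN]
  linarith

theorem abs_sub_truncate_mul_le {K n : ℕ} {x : DecSeq} {r η η₀ δ : ℝ} (hr : 0 ≤ r)
    (hη : η ≤ η₀) (hδ0 : 0 ≤ δ) (hδ : δ ≤ η₀) (hone : 1 ≤ η₀ * r) {z : ℕ → ℕ}
    (hjump : ∀ i ∈ Finset.range K, z i = ⌊x.1 i * r⌋₊) (hfill : z K ≤ ⌊δ * r⌋₊)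
    (hbulk : ∀ i ∈ Finset.Ico (K + 1) n, (z i : ℝ) ≤ η * r) {i : ℕ} (hi : i < n) :
    |(z i : ℝ) - (x.truncate K).1 i * r| ≤ η₀ * r := by
  rcases lt_or_ge i K with hiK | hKi
  · have hx : 0 ≤ (x.1 i : ℝ) * r := by positivity
    rw [hjump i (Finset.mem_range.mpr hiK), x.truncate_of_lt hiK, abs_le]
    constructor <;> linarith [Nat.floor_le hx, Nat.lt_floor_add_one ((x.1 i : ℝ) * r)]
  · rw [x.truncate_of_le hKi, NNReal.coe_zero, zero_mul, sub_zero, Nat.abs_cast]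
    rcases hKi.eq_or_lt with rfl | hKi
    · calc (z K : ℝ) ≤ ⌊δ * r⌋₊ := by exact_mod_cast hfill
        _ ≤ δ * r := Nat.floor_le (by positivity)
        _ ≤ η₀ * r := by gcongr
    · calc (z i : ℝ) ≤ η * r := hbulk i (Finset.mem_Ico.mpr ⟨hKi, hi⟩)
        _ ≤ η₀ * r := by gcongr

theorem stretchedExp_antitone (hc : 0 ≤ c) (hα : 0 ≤ α) : Antitone (stretchedExp c α) :=
  fun k l hkl => by
    unfold stretchedExp
    gcongr

theorem mul_exp_le_stretchedExp_floor (hc : 0 ≤ c) (hα : 0 ≤ α) {a : ℝ} (ha : 0 ≤ a) (n : ℕ) :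
    c * Real.exp (-((n : ℝ) ^ (γ * α) * a ^ α)) ≤ stretchedExp c α ⌊a * (n : ℝ) ^ γ⌋₊ := by
  have hr : 0 ≤ (n : ℝ) ^ γ := by positivity
  have hpow : (⌊a * (n : ℝ) ^ γ⌋₊ : ℝ) ^ α ≤ (n : ℝ) ^ (γ * α) * a ^ α := by
    rw [← natCast_rpow_rpow, mul_comm (_ ^ α), ← Real.mul_rpow ha hr]
    exact Real.rpow_le_rpow (Nat.cast_nonneg _) (Nat.floor_le (by positivity)) hα
  unfold stretchedExp
  gcongr

theorem pow_mul_exp_le_prod_stretchedExp_floor (hc : 0 ≤ c) (hα : 0 ≤ α) {J : Finset ℕ}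
    (x : ℕ → ℝ≥0) (n : ℕ) :
    c ^ J.card * Real.exp (-((n : ℝ) ^ (γ * α) * ∑ i ∈ J, (x i : ℝ) ^ α)) ≤
      ∏ i ∈ J, stretchedExp c α ⌊x i * (n : ℝ) ^ γ⌋₊ := by
  rw [Finset.mul_sum, ← Finset.sum_neg_distrib, Real.exp_sum, ← Finset.prod_const,
    ← Finset.prod_mul_distrib]
  exact Finset.prod_le_prod (fun i _ => by positivity) fun i _ =>
    mul_exp_le_stretchedExp_floor hc hα (x i).coe_nonneg n

theorem IsStretchedExpLaw.mul_measure_truncWindow_le (h : IsStretchedExpLaw α c μ v)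
    (hX : IsIIDWithMass P X (stretchedExp c α)) {K n N : ℕ} (hKn : K < n) {x : DecSeq}
    {O : Set DecSeq} {σ ζ η η₀ : ℝ} (hζ : 0 ≤ ζ) (hζη₀ : 4 * ζ ≤ η₀) (hη : η ≤ η₀)
    (hO : ∀ y : DecSeq, (∀ j, |(y.1 j : ℝ) - (x.truncate K).1 j| ≤ η₀) → y ∈ O)
    (hone : 1 ≤ η₀ * (n : ℝ) ^ γ) (hN : μ * n + σ * (n : ℝ) ^ γ = N)
    (hcenter : |σ - s| * (n : ℝ) ^ γ + (K + |μ| * (K + 1)) ≤ ζ * (n : ℝ) ^ γ) :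
    ENNReal.ofReal (c ^ (K + 1) * Real.exp (-((n : ℝ) ^ (γ * α) *
        (∑ j ∈ Finset.range K, (x.1 j : ℝ) ^ α + (4 * ζ) ^ α)))) *
      P {ω | (fun i => X i ω) ∈ truncWindow (Finset.Ico (K + 1) n) μ (η * (n : ℝ) ^ γ)
        ((s - ∑ j ∈ Finset.range K, (x.1 j : ℝ) - 2 * ζ - ζ) * (n : ℝ) ^ γ)
        ((s - ∑ j ∈ Finset.range K, (x.1 j : ℝ) - 2 * ζ + ζ) * (n : ℝ) ^ γ)} ≤
      P {ω | ((∑ i ∈ Finset.range n, X i ω : ℕ) : ℝ) = μ * n + σ * (n : ℝ) ^ γ ∧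
        scaledOrderStats γ (fun i : Fin n => X i ω) ∈ O} := by
  have hr : 0 ≤ (n : ℝ) ^ γ := by positivity
  have hc := h.c_pos.le
  have hα := h.alpha_pos.le
  have hjumps := hX.prod_mul_le_measure_sum_eq hKn (D := ⌊4 * ζ * (n : ℝ) ^ γ⌋₊)
    (fun d hd => stretchedExp_antitone hc hα hd) (fun i => ⌊x.1 i * (n : ℝ) ^ γ⌋₊)
    (dependsOn_mem_truncWindow _ μ (η * (n : ℝ) ^ γ) _ _)
    (fun z hz => (sum_bounds_of_mem_truncWindow hKn hr hN hcenter hz).1)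
    (fun z hz => (sum_bounds_of_mem_truncWindow hKn hr hN hcenter hz).2)
  rw [← mul_assoc] at hjumps
  refine le_trans (mul_le_mul_left ?_ _) (hjumps.trans (measure_mono ?_))
  · rw [← ENNReal.ofReal_prod_of_nonneg fun i _ => h.nonneg _,
      ← ENNReal.ofReal_mul (Finset.prod_nonneg fun i _ => h.nonneg _)]
    refine ENNReal.ofReal_le_ofReal ?_
    rw [mul_add, neg_add, Real.exp_add, pow_succ, mul_mul_mul_comm]
    gcongr
    · exact Finset.prod_nonneg fun i _ => h.nonneg _
    · simpa only [Finset.card_range] using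
        pow_mul_exp_le_prod_stretchedExp_floor hc hα (J := Finset.range K) x.1 n
    · exact mul_exp_le_stretchedExp_floor hc hα (by positivity) n
  · rintro ω ⟨hjump, hfill, ⟨hbulk, -⟩, hsum⟩
    refine ⟨by rw [hsum, hN], hO _ ?_⟩
    have hη₀ : 0 ≤ η₀ := by linarith
    exact abs_scaledOrderStats_sub_truncate_le (by omega) hKn.le hη₀ fun i =>
      abs_sub_truncate_mul_le hr hη (by positivity) hζη₀ hone hjump hfill hbulk i.2

theorem eventually_center_le (hα1 : α < 1) (hγ : γ = 1 / (2 - α)) {sn : ℕ → ℝ}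
    (hsn : Tendsto sn atTop (𝓝 s)) (C : ℝ) {ζ : ℝ} (hζ : 0 < ζ) :
    ∀ᶠ n : ℕ in atTop, |sn n - s| * (n : ℝ) ^ γ + C ≤ ζ * (n : ℝ) ^ γ := by
  have hr := tendsto_scale hα1 hγ
  have hlim : Tendsto (fun n : ℕ => |sn n - s| + C * ((n : ℝ) ^ γ)⁻¹) atTop
      (𝓝 (|s - s| + C * 0)) :=
    (hsn.sub_const s).abs.add (hr.inv_tendsto_atTop.const_mul C)
  filter_upwards [hlim.eventually_le_const (by simpa using hζ), hr.eventually_gt_atTop 0]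
    with n hle hpos
  have hmul := mul_le_mul_of_nonneg_right hle hpos.le
  rwa [add_mul, mul_assoc, inv_mul_cancel₀ hpos.ne', mul_one] at hmul

theorem exp_le_mul_exp_mul_exp {V C A B L p : ℝ} (hC : 0 < C)
    (hCV : C⁻¹ ≤ Real.exp (V * ((L - (A + B)) / 2)))
    (hp : Real.exp (-(V * (B + (L - (A + B)) / 2))) ≤ p) :
    Real.exp (-(V * L)) ≤ C * Real.exp (-(V * A)) * p := by
  rw [inv_le_iff_one_le_mul₀' hC] at hCV
  calc Real.exp (-(V * L))
      ≤ Real.exp (-(V * L)) * (C * Real.exp (V * ((L - (A + B)) / 2))) :=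
        le_mul_of_one_le_right (Real.exp_pos _).le hCV
    _ = C * Real.exp (-(V * A)) * Real.exp (-(V * (B + (L - (A + B)) / 2))) := by
        rw [mul_left_comm, ← Real.exp_add, mul_assoc, ← Real.exp_add]
        ring_nf
    _ ≤ C * Real.exp (-(V * A)) * p := by gcongr

theorem IsStretchedExpLaw.eventually_exp_le_measure_mem_isOpen [IsFiniteMeasure P]
    (h : IsStretchedExpLaw α c μ v) (hX : IsIIDWithMass P X (stretchedExp c α))
    (hγ : γ = 1 / (2 - α)) {sn : ℕ → ℝ} (hsn : Tendsto sn atTop (𝓝 s))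
    (hint : ∀ n : ℕ, 1 ≤ n → ∃ N : ℕ, μ * n + sn n * (n : ℝ) ^ γ = N) {O : Set DecSeq}
    (hO : IsOpen O) {x : DecSeq} (hx : x ∈ O) {L : ℝ≥0} (hL : energy α v s x < L) :
    ∀ᶠ n : ℕ in atTop, ENNReal.ofReal (Real.exp (-((n : ℝ) ^ (γ * α) * L))) ≤
      P {ω | ((∑ i ∈ Finset.range n, X i ω : ℕ) : ℝ) = μ * n + sn n * (n : ℝ) ^ γ ∧
        scaledOrderStats γ (fun i : Fin n => X i ω) ∈ O} := by
  have hα0 := h.alpha_pos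
  have hα1 := h.alpha_lt_one
  obtain ⟨K, hxO, hxL⟩ := exists_truncate_mem_and_lt hα0 h.var_pos hL hO hx
  obtain ⟨η₀, hη₀, hball⟩ := exists_forall_abs_sub_le_imp_mem hO hxO
  obtain ⟨ζ, hζ, hζη₀, hζL⟩ := exists_window_width hα0 hη₀ hxL
  set u := s - ∑ j ∈ Finset.range K, (x.1 j : ℝ) - 2 * ζ
  obtain ⟨η, hη, hηη₀, huη⟩ := exists_truncation_level hα1 ((|u| + ζ) / v) hη₀
  have hC : 0 < c ^ (K + 1) := pow_pos h.c_pos _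
  filter_upwards [h.eventually_exp_le_measure_truncWindow hX hγ hζ hη huη (K + 1)
      (half_pos (sub_pos.mpr hζL)), eventually_center_le hα1 hγ hsn (K + |μ| * (K + 1)) hζ,
    eventually_le_exp_speed_mul hα0 hα1 hγ (half_pos (sub_pos.mpr hζL)) (c ^ (K + 1))⁻¹,
    (tendsto_scale hα1 hγ).eventually_ge_atTop (1 / η₀), eventually_gt_atTop K]
    with n hwindow hcenter hcost hscale hKn
  obtain ⟨N, hN⟩ := hint n (by omega)
  rw [div_le_iff₀' hη₀] at hscale
  refine le_trans ?_ (h.mul_measure_truncWindow_le hX hKn hζ.le hζη₀ hηη₀ hball hscale hN hcenter)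
  rw [← ofReal_measureReal (μ := P), ← ENNReal.ofReal_mul (by positivity)]
  exact ENNReal.ofReal_le_ofReal (exp_le_mul_exp_mul_exp hC hcost hwindow)

end LowerBound

section Law

variable {Ω : Type*} [MeasurableSpace Ω] {P : Measure Ω} {X : ℕ → Ω → ℕ} {p : ℕ → ℝ}
  {α c : ℝ}

theorem IsIIDWithMass.hasSum_integral (h : IsIIDWithMass P X p) {g : ℕ → ℝ}
    (hg : Summable fun k => p k * |g k|) (i : ℕ) :
    HasSum (fun k => p k * g k) (∫ ω, g (X i ω) ∂P) := by
  have hmass (k : ℕ) : (P.map (X i)) {k} = ENNReal.ofReal (p k) := by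
    rw [Measure.map_apply (h.measurable i) (measurableSet_singleton k), ← h.law i k]
    rfl
  have hreal (k : ℕ) : ((P.map (X i)) {k}).toReal = p k := by
    rw [hmass, ENNReal.toReal_ofReal (h.nonneg k)]
  have hsum := hasSum_integral_sum_dirac (f := g) (x := fun k : ℕ => k)
    (c := fun k => (P.map (X i)) {k}) (fun k => by rw [hmass]; exact ENNReal.ofReal_ne_top)
    (by simpa only [hreal, Real.norm_eq_abs] using hg)
  rw [Measure.sum_smul_dirac, integral_map (h.measurable i).aemeasurable
    (measurable_of_countable g).aestronglyMeasurable] at hsum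
  simpa only [hreal, smul_eq_mul] using hsum

theorem IsIIDWithMass.hasMeanVariance [IsProbabilityMeasure P] (h : IsIIDWithMass P X p)
    (hp : Summable fun k : ℕ => p k * ((k : ℝ) + 1) ^ 2) :
    HasMeanVariance p (∫ ω, (X 0 ω : ℝ) ∂P) (variance (fun ω => (X 0 ω : ℝ)) P) := by
  set μ := ∫ ω, (X 0 ω : ℝ) ∂P
  have hsum (g : ℕ → ℝ) (C : ℝ) (hg : ∀ k, |g k| ≤ C * ((k : ℝ) + 1) ^ 2) :
      HasSum (fun k => p k * g k) (∫ ω, g (X 0 ω) ∂P) := by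
    refine h.hasSum_integral ((hp.mul_left C).of_nonneg_of_le
      (fun k => mul_nonneg (h.nonneg k) (abs_nonneg _)) fun k => ?_) 0
    rw [mul_left_comm]
    exact mul_le_mul_of_nonneg_left (hg k) (h.nonneg k)
  have hmass : HasSum p 1 := by
    simpa using hsum (fun _ => 1) 1 fun k => by
      rw [abs_one, one_mul]
      exact one_le_pow₀ (by simp)
  have hmean : HasSum (fun k : ℕ => p k * k) μ := hsum (fun k => k) 1 fun k => by
    rw [Nat.abs_cast]
    nlinarith [k.cast_nonneg (α := ℝ)]
  have hcentered := hmean.sub (hmass.mul_right μ)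
  simp only [one_mul, sub_self, ← mul_sub] at hcentered
  have hX0 : AEMeasurable (fun ω => (X 0 ω : ℝ)) P :=
    (measurable_from_nat.comp (h.measurable 0)).aemeasurable
  refine ⟨h.nonneg, hmass, hcentered, ?_⟩
  rw [variance_eq_integral hX0]
  refine hsum (fun k => ((k : ℝ) - μ) ^ 2) ((1 + |μ|) ^ 2) fun k => ?_
  rw [abs_pow, ← mul_pow]
  gcongr
  calc |(k : ℝ) - μ| ≤ |(k : ℝ)| + |μ| := abs_sub _ _
    _ ≤ (1 + |μ|) * (k + 1) := by
      rw [Nat.abs_cast]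
      nlinarith [mul_nonneg (abs_nonneg μ) k.cast_nonneg]

theorem HasMeanVariance.var_pos {μ v : ℝ} (h : HasMeanVariance p μ v) {j k : ℕ} (hjk : j ≠ k)
    (hj : 0 < p j) (hk : 0 < p k) : 0 < v := by
  have hle (i : ℕ) : p i * (i - μ) ^ 2 ≤ v :=
    le_hasSum h.var i fun i' _ => mul_nonneg (h.nonneg i') (sq_nonneg _)
  have hne : (j : ℝ) ≠ k := Nat.cast_injective.ne hjk
  rcases eq_or_ne (j : ℝ) μ with rfl | hjμ
  · exact (mul_pos hk (sq_pos_of_ne_zero (sub_ne_zero.mpr hne.symm))).trans_le (hle k)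
  · exact (mul_pos hj (sq_pos_of_ne_zero (sub_ne_zero.mpr hjμ))).trans_le (hle j)

theorem IsIIDWithMass.isStretchedExpLaw [IsProbabilityMeasure P]
    (h : IsIIDWithMass P X (stretchedExp c α)) (hc : 0 < c) (hα0 : 0 < α) (hα1 : α < 1) :
    IsStretchedExpLaw α c (∫ ω, (X 0 ω : ℝ) ∂P) (variance (fun ω => (X 0 ω : ℝ)) P) := by
  have hsum : Summable fun k : ℕ => stretchedExp c α k * ((k : ℝ) + 1) ^ 2 := by
    refine ((summable_add_pow_mul_exp_neg_rpow hα0 one_pos 1 2).mul_left c).congr fun k => ?_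
    rw [stretchedExp, neg_one_mul]
    ring
  have hpos (k : ℕ) : 0 < stretchedExp c α k := mul_pos hc (Real.exp_pos _)
  have hmv := h.hasMeanVariance hsum
  exact ⟨hmv, hα0, hα1, hc, hmv.var_pos zero_ne_one (hpos 0) (hpos 1)⟩

theorem one_div_tsum_exp_neg_rpow_pos (hα : 0 < α) :
    0 < 1 / ∑' k : ℕ, Real.exp (-(k : ℝ) ^ α) := by
  have hsum : Summable fun k : ℕ => Real.exp (-(k : ℝ) ^ α) := by
    simpa using summable_add_pow_mul_exp_neg_rpow hα one_pos 0 0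
  exact one_div_pos.mpr (hsum.tsum_pos (fun k => (Real.exp_pos _).le) 0 (Real.exp_pos _))

end Law

/-! ### Conditioning on the sum -/

section Conditioned

variable {Ω : Type*} [MeasurableSpace Ω] {X : ℕ → Ω → ℕ}

theorem measurable_scaledOrderStats (hX : ∀ i, Measurable (X i)) (γ : ℝ) (n : ℕ) :
    Measurable fun ω => scaledOrderStats γ (fun i : Fin n => X i ω) :=
  (measurable_of_countable fun x : Fin n → ℕ => scaledOrderStats γ x).comp
    (measurable_pi_lambda _ fun i : Fin n => hX i)

theorem measurableSet_sum_eq (hX : ∀ i, Measurable (X i)) (n : ℕ) (b : ℝ) :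
    MeasurableSet {ω | ((∑ i ∈ Finset.range n, X i ω : ℕ) : ℝ) = b} :=
  (measurable_from_nat.comp (Finset.measurable_sum _ fun i _ => hX i)) (measurableSet_singleton b)

/-- The law of the scaled order statistics of `X 0, …, X (n - 1)` on the event that their sum is
`b`: a measure of total mass `P (S_n = b)`, the unnormalised form of the conditional law. -/
noncomputable def orderStatsOnSum (P : Measure Ω) (X : ℕ → Ω → ℕ) (γ : ℝ) (n : ℕ) (b : ℝ) :
    Measure DecSeq :=
  (P.restrict {ω | ((∑ i ∈ Finset.range n, X i ω : ℕ) : ℝ) = b}).map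
    fun ω => scaledOrderStats γ (fun i : Fin n => X i ω)

variable {P : Measure Ω}

theorem orderStatsOnSum_apply (hX : ∀ i, Measurable (X i)) (γ : ℝ) (n : ℕ) (b : ℝ)
    {A : Set DecSeq} (hA : MeasurableSet A) :
    orderStatsOnSum P X γ n b A = P {ω | ((∑ i ∈ Finset.range n, X i ω : ℕ) : ℝ) = b ∧
      scaledOrderStats γ (fun i : Fin n => X i ω) ∈ A} := by
  rw [orderStatsOnSum, Measure.map_apply (measurable_scaledOrderStats hX γ n) hA,
    Measure.restrict_apply' (measurableSet_sum_eq hX n b), Set.inter_comm]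
  rfl

theorem map_cond_eq_inv_smul_orderStatsOnSum (hX : ∀ i, Measurable (X i)) (γ : ℝ) (n : ℕ)
    (b : ℝ) :
    (cond P {ω | ((∑ i ∈ Finset.range n, X i ω : ℕ) : ℝ) = b}).map
        (fun ω => scaledOrderStats γ (fun i : Fin n => X i ω)) =
      (orderStatsOnSum P X γ n b Set.univ)⁻¹ • orderStatsOnSum P X γ n b := by
  rw [orderStatsOnSum_apply hX γ n b MeasurableSet.univ, ProbabilityTheory.cond,
    Measure.map_smul, orderStatsOnSum]
  simp only [Set.mem_univ, and_true]

theorem IsStretchedExpLaw.satisfiesLDP_orderStatsOnSum [IsProbabilityMeasure P]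
    {α c μ v γ s : ℝ} (h : IsStretchedExpLaw α c μ v)
    (hX : IsIIDWithMass P X (stretchedExp c α)) (hγ : γ = 1 / (2 - α)) {sn : ℕ → ℝ}
    (hsn : Tendsto sn atTop (𝓝 s))
    (hint : ∀ n : ℕ, 1 ≤ n → ∃ N : ℕ, μ * n + sn n * (n : ℝ) ^ γ = N) :
    SatisfiesLDP (fun n => orderStatsOnSum P X γ n (μ * n + sn n * (n : ℝ) ^ γ))
      (fun n => (n : ℝ) ^ (γ * α)) (energy α v s) := by
  have hα0 := h.alpha_pos
  have hα1 := h.alpha_lt_one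
  have happly (n : ℕ) {A : Set DecSeq} (hA : MeasurableSet A) :=
    orderStatsOnSum_apply (P := P) hX.measurable γ n (μ * n + sn n * (n : ℝ) ^ γ) hA
  refine satisfiesLDP_of_local_bounds (fun n => ?_) (tendsto_speed hα0 hα1 hγ)
    (lowerSemicontinuous_energy hα0 hα1 h.var_pos) (isCompact_energy_le hα0 hα1 h.var_pos)
    (fun x L hL => ?_) (fun L => ?_) fun x L hL O hO hx => ?_
  · rw [happly n MeasurableSet.univ]
    exact prob_le_one
  · obtain ⟨U, hU, hbound⟩ := h.exists_nhds_measure_le hX hγ hsn hL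
    refine ⟨interior U, interior_mem_nhds.mpr hU, hbound.mono fun n hn => ?_⟩
    rw [happly n isOpen_interior.measurableSet]
    refine le_trans (measure_mono ?_) hn
    exact fun ω hω => ⟨hω.1, interior_subset hω.2⟩
  · obtain ⟨M, hM⟩ := hX.exists_measure_largest_gt_le h.c_pos hα0 hα1 hγ L
    have hK := isCompact_apply_zero_le M
    refine ⟨_, hK, hM.mono fun n hn => ?_⟩
    rw [happly n hK.isClosed.measurableSet.compl]
    refine le_trans (measure_mono ?_) hn
    rintro ω ⟨-, hω⟩
    rwa [Set.mem_compl_iff, Set.mem_ofPred_eq, not_le] at hω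
  · filter_upwards [h.eventually_exp_le_measure_mem_isOpen hX hγ hsn hint hO hx hL] with n hn
    rwa [happly n hO.measurableSet]

end Conditioned

theorem theorem2p2 {Ω : Type*} [MeasurableSpace Ω] (P : Measure Ω) [IsProbabilityMeasure P]
    (α : ℝ) (hα0 : 0 < α) (hα1 : α < 1)
    (c : ℝ) (hc : c = 1 / ∑' k : ℕ, Real.exp (-(k : ℝ) ^ α))
    (X : ℕ → Ω → ℕ) (hX : ∀ i, Measurable (X i)) (hindep : iIndepFun X P)
    (hlaw : ∀ i k, P {ω | X i ω = k} = ENNReal.ofReal (c * Real.exp (-(k : ℝ) ^ α)))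
    (μ : ℝ) (hμ : μ = ∫ ω, (X 0 ω : ℝ) ∂P)
    (σ : ℝ) (hσ : σ ^ 2 = variance (fun ω => (X 0 ω : ℝ)) P)
    (γ : ℝ) (hγ : γ = 1 / (2 - α))
    (s : ℝ) (sn : ℕ → ℝ) (hsn : Tendsto sn atTop (𝓝 s))
    (hint : ∀ n : ℕ, 1 ≤ n → ∃ N : ℕ, μ * n + sn n * (n : ℝ) ^ γ = N) :
    SatisfiesLDP
      (fun n => Measure.map (fun ω => scaledOrderStats γ (fun i : Fin n => X i ω))
        (cond P {ω | ((∑ i ∈ Finset.range n, X i ω : ℕ) : ℝ) = μ * n + sn n * (n : ℝ) ^ γ}))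
      (fun n => (n : ℝ) ^ (γ * α))
      (fun x => energy α (σ ^ 2) s x - ⨅ y, energy α (σ ^ 2) s y) := by
  have hc_pos : 0 < c := hc ▸ one_div_tsum_exp_neg_rpow_pos hα0
  have hiid : IsIIDWithMass P X (stretchedExp c α) :=
    ⟨hX, hindep, fun k => mul_nonneg hc_pos.le (Real.exp_pos _).le, hlaw⟩
  have hlaw_params : IsStretchedExpLaw α c μ (σ ^ 2) := by
    rw [hμ, hσ]
    exact hiid.isStretchedExpLaw hc_pos hα0 hα1
  simp only [map_cond_eq_inv_smul_orderStatsOnSum hX]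
  exact (hlaw_params.satisfiesLDP_orderStatsOnSum hiid hγ hsn hint).normalize
    (iInf_energy_ne_top hα0 hlaw_params.var_pos)
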